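/- For positive integers $m_0,m,m_1$ with $m_0\mid m$ and $m_1\mid m$, let $$I[m_0,m,m_1]=\{f\in C([0,1],M_m(\mathbb C)) : f(0)=a_0\otimes 1_{m/m_0},\ f(1)=a_1\otimes 1_{m/m_1}\text{ for some } a_0\in M_{m_0}(\mathbb C),\ a_1\in M_{m_1}(\mathbb C)\}$$ be the generalized dimension drop interval algebra. (Matrix algebras over these are again of this form, as $M_r(I[m_0,m,m_1])\cong I[rm_0,rm,rm_1]$.) For a finite subset $F$ of a finite direct sum $\bigoplus_{i=1}^k I[m_{0,i},m_i,m_{1,i}]$, define the weak variation of $F$ by $$\omega(F)=\max_{1\le i\le k}\ \sup_{s,t\in[0,1]}\ \inf_{u\in U(m_i)}\ \max_{f\in F}\ \|u f_i(s)u^*-f_i(t)\|,$$ where $f_i$ is the $i$-th component of $f$ and $U(m_i)$ is the unitary group of $M_{m_i}(\mathbb C)$ (a maximum over the empty set is $0$). A C*-algebra has real rank zero if the invertible self-adjoint elements are dense in the self-adjoint elements of the C*-algebra obtained from it by adjoining a unit (equivalently, of the algebra itself if it is unital). Let $A=\varinjlim(A_n,\nu_{n,m})$ be the C*-algebra inductive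 limit of a sequence $(A_n)_{n\in\mathbb N}$ of finite direct sums of generalized dimension drop interval algebras, with $*$-homomorphisms $\nu_{n,m}\colon A_n\to A_m$ ($n\le m$), not necessarily unital or injective, and suppose that $A$ has real rank zero. Then, for every $n$ and every finite subset $F\subset A_n$, $$\lim_{r\to\infty}\omega(\nu_{n,r}(F))=0 .$$ -/

import Mathlib

open Filter Topology
open scoped Matrix Kronecker ENNReal Matrix.Norms.L2Operator

noncomputable section

namespace DimDrop

/-- The index bijection `{1..k} × {1..m/k} ≃ {1..m}` (lexicographic order) when `k` divides `m`. -/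
def tensorIndex {k m : ℕ} (h : k ∣ m) : Fin k × Fin (m / k) ≃ Fin m :=
  finProdFinEquiv.trans (finCongr (Nat.mul_div_cancel' h))

/-- The unital embedding `a ↦ a ⊗ 1_{m/k}` of `M_k(ℂ)` into `M_m(ℂ)`, for `k` dividing `m`. -/
def tensorOne {k m : ℕ} (h : k ∣ m) (a : Matrix (Fin k) (Fin k) ℂ) : Matrix (Fin m) (Fin m) ℂ :=
  Matrix.reindex (tensorIndex h) (tensorIndex h)
    (a ⊗ₖ (1 : Matrix (Fin (m / k)) (Fin (m / k)) ℂ))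

theorem tensorOne_add {k m : ℕ} (h : k ∣ m) (a b : Matrix (Fin k) (Fin k) ℂ) :
    tensorOne h (a + b) = tensorOne h a + tensorOne h b := by
  ext i j
  simp [tensorOne, Matrix.kroneckerMap_apply, add_mul]

theorem tensorOne_mul {k m : ℕ} (h : k ∣ m) (a b : Matrix (Fin k) (Fin k) ℂ) :
    tensorOne h (a * b) = tensorOne h a * tensorOne h b := by
  have := Matrix.mul_kronecker_mul a b (1 : Matrix (Fin (m / k)) (Fin (m / k)) ℂ)
    (1 : Matrix (Fin (m / k)) (Fin (m / k)) ℂ)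
  rw [mul_one] at this
  simp only [tensorOne, Matrix.reindex_apply, this, Matrix.submatrix_mul_equiv]

theorem tensorOne_scalar {k m : ℕ} (h : k ∣ m) (c : ℂ) :
    tensorOne h (algebraMap ℂ _ c) = algebraMap ℂ _ c := by
  simp only [tensorOne, Algebra.algebraMap_eq_smul_one, Matrix.smul_kronecker,
    Matrix.one_kronecker_one, Matrix.reindex_apply]
  ext i j
  simp [Matrix.one_apply]

theorem tensorOne_star {k m : ℕ} (h : k ∣ m) (a : Matrix (Fin k) (Fin k) ℂ) :
    tensorOne h (star a) = star (tensorOne h a) := by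
  simp only [tensorOne, Matrix.star_eq_conjTranspose, Matrix.reindex_apply,
    Matrix.conjTranspose_submatrix, Matrix.conjTranspose_kronecker, Matrix.conjTranspose_one]

/-- The parameters `(m₀, m, m₁)` of a generalized dimension drop interval algebra:
`m` is a positive integer, and `m₀` and `m₁` are divisors of `m`. -/
structure Params where
  m₀ : ℕ
  m : ℕ
  m₁ : ℕ
  pos : 0 < m
  dvd₀ : m₀ ∣ m
  dvd₁ : m₁ ∣ m

/-- The generalized dimension drop interval algebra `I[m₀, m, m₁]`: the continuous functions
`f : [0,1] → M_m(ℂ)` with `f(0) = a₀ ⊗ 1_{m/m₀}` and `f(1) = a₁ ⊗ 1_{m/m₁}` for some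
`a₀ ∈ M_{m₀}(ℂ)`, `a₁ ∈ M_{m₁}(ℂ)`, with pointwise operations and the supremum of the
operator norm. -/
def interval (p : Params) : StarSubalgebra ℂ C(unitInterval, Matrix (Fin p.m) (Fin p.m) ℂ) where
  carrier := {f | (∃ a₀, f 0 = tensorOne p.dvd₀ a₀) ∧ (∃ a₁, f 1 = tensorOne p.dvd₁ a₁)}
  mul_mem' := by
    rintro f g ⟨⟨a, ha⟩, ⟨b, hb⟩⟩ ⟨⟨c, hc⟩, ⟨d, hd⟩⟩
    exact ⟨⟨a * c, by simp [ha, hc, tensorOne_mul]⟩, ⟨b * d, by simp [hb, hd, tensorOne_mul]⟩⟩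
  add_mem' := by
    rintro f g ⟨⟨a, ha⟩, ⟨b, hb⟩⟩ ⟨⟨c, hc⟩, ⟨d, hd⟩⟩
    exact ⟨⟨a + c, by simp [ha, hc, tensorOne_add]⟩, ⟨b + d, by simp [hb, hd, tensorOne_add]⟩⟩
  algebraMap_mem' c :=
    ⟨⟨algebraMap ℂ _ c, by rw [tensorOne_scalar]; rfl⟩,
      ⟨algebraMap ℂ _ c, by rw [tensorOne_scalar]; rfl⟩⟩
  star_mem' := by
    rintro f ⟨⟨a, ha⟩, ⟨b, hb⟩⟩
    exact ⟨⟨star a, by rw [tensorOne_star, ← ha]; rfl⟩, ⟨star b, by rw [tensorOne_star, ← hb]; rfl⟩⟩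

theorem isClosed_range_tensorOne {k m : ℕ} (h : k ∣ m) :
    IsClosed (Set.range (tensorOne h)) := by
  let L : Matrix (Fin k) (Fin k) ℂ →ₗ[ℂ] Matrix (Fin m) (Fin m) ℂ :=
    { toFun := tensorOne h
      map_add' := tensorOne_add h
      map_smul' := fun c a => by
        ext i j
        simp [tensorOne, Matrix.smul_kronecker] }
  exact (LinearMap.range L).closed_of_finiteDimensional

instance interval_isClosed (p : Params) :
    IsClosed (interval p : Set C(unitInterval, Matrix (Fin p.m) (Fin p.m) ℂ)) := by
  have h0 := (isClosed_range_tensorOne p.dvd₀).preimage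
    (continuous_eval_const (F := C(unitInterval, Matrix (Fin p.m) (Fin p.m) ℂ)) 0)
  have h1 := (isClosed_range_tensorOne p.dvd₁).preimage
    (continuous_eval_const (F := C(unitInterval, Matrix (Fin p.m) (Fin p.m) ℂ)) 1)
  convert h0.inter h1 using 1
  ext f
  simp [interval, eq_comm]

/-- The finite direct sum `⨁ᵢ I[m₀ᵢ, mᵢ, m₁ᵢ]`, with coordinatewise operations and the
maximum norm. -/
abbrev FinSum {k : ℕ} (p : Fin k → Params) : Type := ∀ i, interval (p i)

/-- The weak variation of a set `F` in a finite direct sum of generalized dimension drop interval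
algebras: the maximum over the summands `i` of
`sup_{s,t ∈ [0,1]} inf_{u ∈ U(mᵢ)} sup_{f ∈ F} ‖u fᵢ(s) u* - fᵢ(t)‖`.
It takes values in `[0, ∞]` so that all suprema and infima exist. -/
def weakVariation {k : ℕ} {p : Fin k → Params} (F : Set (FinSum p)) : ℝ≥0∞ :=
  ⨆ (i : Fin k) (s : unitInterval) (t : unitInterval),
    ⨅ u : Matrix.unitaryGroup (Fin (p i).m) ℂ,
      ⨆ f ∈ F, ‖(u : Matrix (Fin (p i).m) (Fin (p i).m) ℂ) * (f i).1 s *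
        star (u : Matrix (Fin (p i).m) (Fin (p i).m) ℂ) - (f i).1 t‖ₑ

/-- A unital C*-algebra has real rank zero if the invertible self-adjoint elements are dense in
the set of self-adjoint elements. -/
def UnitalRealRankZero (B : Type*) [CStarAlgebra B] : Prop :=
  {b : B | IsSelfAdjoint b} ⊆ closure {b : B | IsSelfAdjoint b ∧ IsUnit b}

/-- An arbitrary C*-algebra has real rank zero if the algebra obtained by adjoining a unit does. -/
def RealRankZero (A : Type*) [NonUnitalCStarAlgebra A] : Prop :=
  UnitalRealRankZero (Unitization ℂ A)

/-- The maps `ν_{n,m} : A_n → A_m`, `n ≤ m`, form an inductive sequence of C*-algebras. -/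
structure IsInductiveSequence {A : ℕ → Type*} [∀ n, NonUnitalCStarAlgebra (A n)]
    (ν : ∀ n m, n ≤ m → (A n →⋆ₙₐ[ℂ] A m)) : Prop where
  map_self : ∀ n (a : A n), ν n n le_rfl a = a
  map_map : ∀ n m r (hnm : n ≤ m) (hmr : m ≤ r) (a : A n),
    ν m r hmr (ν n m hnm a) = ν n r (hnm.trans hmr) a

/-- The C*-algebra `L` with the canonical maps `ι_n : A_n → L` is the inductive limit of the
sequence `(A_n, ν_{n,m})`, that is, the completion of the algebraic direct limit for the
C*-seminorm `lim_r ‖ν_{n,r}(a)‖`. -/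
structure IsInductiveLimit {A : ℕ → Type*} [∀ n, NonUnitalCStarAlgebra (A n)]
    (ν : ∀ n m, n ≤ m → (A n →⋆ₙₐ[ℂ] A m)) {L : Type*} [NonUnitalCStarAlgebra L]
    (ι : ∀ n, A n →⋆ₙₐ[ℂ] L) : Prop where
  compatible : ∀ n m (h : n ≤ m) (a : A n), ι m (ν n m h a) = ι n a
  norm_eq : ∀ n (a : A n),
    Tendsto (fun r : Set.Ici n => ‖ν n r r.2 a‖) atTop (𝓝 ‖ι n a‖)
  dense : Dense (⋃ n, Set.range (ι n))

end DimDrop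

end

/-! Composing `ν n r` with the evaluations at the points of one summand of the `r`-th algebra gives
a continuous path of finite-dimensional representations of the `n`-th algebra. The claim is that any
two representations on such a path are almost unitarily equivalent on `F` once `r` is large. They
are compared through the central self-adjoint elements `central p i heightFun`, equal to `1 + s` on
summand `i` and to `0` on the others.

Analytic half (`exists_eigenCount_le`): by real rank zero, the image of such an element in the limit
is close to a self-adjoint element of the unitization whose spectrum misses a prescribed finite
grid. This invertibility is already visible at a finite stage, so along the path a nearby operator
never has a grid point as an eigenvalue. As the interval is connected, its number of eigenvalues
above each grid point is constant. Hence the eigenvalue counting functions of the heights at two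
points of the path agree up to a shift by `δ`.

Algebraic half (`exists_decomposition`, `Decomposition.mult_eq_of_path`): each representation is an
orthogonal sum of evaluations, irreducible representations at the ends of summands, and zero
representations. Since `m / m₀` left-end copies form an evaluation at `0`, and likewise `m / m₁`
right-end copies one at `1`, the end multiplicities can be kept below these numbers. Reduction
modulo `m` then recovers them from eigenvalue counts, so all multiplicities are constant along the
path. The shift by `1` in the height separates a summand (heights in `[1, 2]`) from everything else
(height `0`).

With equal multiplicities and close counting functions, the sorted evaluation points are pairwise
`δ`-close (`Decomposition.x_le`). The unitary matching the adapted bases, with uniform continuity of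
the elements of `F`, finishes the proof. -/

namespace DimDrop

/-! ### Eigenvalue counting by a min-max principle. -/

section EigenCount

variable {V : Type*} [NormedAddCommGroup V] [InnerProductSpace ℂ V] [FiniteDimensional ℂ V]

/-- The largest dimension of a subspace on which the quadratic form of `T` exceeds `y`; for a
self-adjoint `T` this is the number of eigenvalues greater than `y`. -/
noncomputable def eigenCount (T : V →L[ℂ] V) (y : ℝ) : ℕ :=
  sSup {d | ∃ W : Submodule ℂ V, Module.finrank ℂ W = d ∧
    ∀ v ∈ W, v ≠ 0 → y * ‖v‖ ^ 2 < (inner ℂ v (T v)).re}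

theorem eigenCount_bddAbove (T : V →L[ℂ] V) (y : ℝ) :
    BddAbove {d | ∃ W : Submodule ℂ V, Module.finrank ℂ W = d ∧
      ∀ v ∈ W, v ≠ 0 → y * ‖v‖ ^ 2 < (inner ℂ v (T v)).re} := by
  refine ⟨Module.finrank ℂ V, ?_⟩
  rintro d ⟨W, rfl, -⟩
  exact Submodule.finrank_le W

theorem finrank_le_eigenCount {T : V →L[ℂ] V} {y : ℝ} {W : Submodule ℂ V}
    (hW : ∀ v ∈ W, v ≠ 0 → y * ‖v‖ ^ 2 < (inner ℂ v (T v)).re) :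
    Module.finrank ℂ W ≤ eigenCount T y :=
  le_csSup (eigenCount_bddAbove T y) ⟨W, rfl, hW⟩

theorem exists_finrank_eq_eigenCount (T : V →L[ℂ] V) (y : ℝ) :
    ∃ W : Submodule ℂ V, Module.finrank ℂ W = eigenCount T y ∧
      ∀ v ∈ W, v ≠ 0 → y * ‖v‖ ^ 2 < (inner ℂ v (T v)).re :=
  Nat.sSup_mem (s := {d | ∃ W : Submodule ℂ V, Module.finrank ℂ W = d ∧
    ∀ v ∈ W, v ≠ 0 → y * ‖v‖ ^ 2 < (inner ℂ v (T v)).re})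
    ⟨0, ⊥, by simp, by simp +contextual⟩ (eigenCount_bddAbove T y)

/-- The quadratic forms differ by at most `ε ‖v‖ ^ 2`, so a subspace that is optimal for `T` still
serves for `T'`. -/
theorem eigenCount_add_le {T T' : V →L[ℂ] V} {ε : ℝ} (h : ‖T - T'‖ ≤ ε) (y : ℝ) :
    eigenCount T (y + ε) ≤ eigenCount T' y := by
  obtain ⟨W, hW, hv⟩ := exists_finrank_eq_eigenCount T (y + ε)
  rw [← hW]
  refine finrank_le_eigenCount fun v hvW h0 => ?_
  have h1 := hv v hvW h0
  have h2 : (inner ℂ v ((T - T') v)).re ≤ ε * ‖v‖ ^ 2 := by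
    calc (inner ℂ v ((T - T') v)).re ≤ ‖v‖ * ‖(T - T') v‖ := re_inner_le_norm (𝕜 := ℂ) _ _
      _ ≤ ‖v‖ * (ε * ‖v‖) := by
        gcongr
        exact (T - T').le_of_opNorm_le h v
      _ = ε * ‖v‖ ^ 2 := by ring
  rw [_root_.sub_apply, inner_sub_right, Complex.sub_re] at h2
  linarith

theorem eigenCount_anti (T : V →L[ℂ] V) {y y' : ℝ} (h : y ≤ y') :
    eigenCount T y' ≤ eigenCount T y := by
  have := eigenCount_add_le (T := T) (T' := T) (ε := y' - y) (by simpa using h) y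
  simpa using this

variable {κ : Type*} [Fintype κ]

omit [FiniteDimensional ℂ V] in
theorem re_inner_apply_of_eigenbasis (b : OrthonormalBasis κ ℂ V) {T : V →L[ℂ] V} {lam : κ → ℝ}
    (hT : ∀ i, T (b i) = (lam i : ℂ) • b i) (v : V) :
    (inner ℂ v (T v)).re = ∑ i, lam i * ‖inner ℂ (b i) v‖ ^ 2 := by
  have h1 : T v = ∑ i, (inner ℂ (b i) v * (lam i : ℂ)) • b i := by
    conv_lhs => rw [← b.sum_repr' v]
    simp only [map_sum, map_smul, hT, smul_smul]
  rw [h1, inner_sum, Complex.re_sum]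
  refine Finset.sum_congr rfl fun i _ => ?_
  rw [inner_smul_right, ← inner_conj_symm v (b i), mul_right_comm, Complex.mul_conj,
    Complex.normSq_eq_norm_sq, ← Complex.ofReal_mul, Complex.ofReal_re, mul_comm]

omit [FiniteDimensional ℂ V] in
theorem inner_eq_zero_of_mem_span_image (b : OrthonormalBasis κ ℂ V) {s : Set κ} {v : V}
    (hv : v ∈ Submodule.span ℂ (b '' s)) {i : κ} (hi : i ∉ s) : inner ℂ (b i) v = 0 := by
  induction hv using Submodule.span_induction with
  | mem x hx =>
    obtain ⟨j, hj, rfl⟩ := hx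
    exact b.orthonormal.inner_eq_zero (fun h => hi (h ▸ hj))
  | zero => simp
  | add x y _ _ hx hy => rw [inner_add_right, hx, hy, add_zero]
  | smul c x _ hx => rw [inner_smul_right, hx, mul_zero]

omit [FiniteDimensional ℂ V] in
theorem finrank_span_image (b : OrthonormalBasis κ ℂ V) (s : Finset κ) :
    Module.finrank ℂ (Submodule.span ℂ (b '' (s : Set κ))) = s.card := by
  rw [Set.image_eq_range]
  have hli : LinearIndependent ℂ (fun x : (s : Set κ) => b x) :=
    b.orthonormal.linearIndependent.comp _ Subtype.val_injective
  have := finrank_span_eq_card hli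
  simpa using this

/-- An admissible subspace meets the span of the eigenvectors with eigenvalue at most `y` trivially,
which bounds its dimension; the span of the remaining eigenvectors attains the bound. -/
theorem eigenCount_eq_card (b : OrthonormalBasis κ ℂ V) {T : V →L[ℂ] V} {lam : κ → ℝ}
    (hT : ∀ i, T (b i) = (lam i : ℂ) • b i) (y : ℝ) :
    eigenCount T y = (Finset.univ.filter fun i => y < lam i).card := by
  classical
  apply le_antisymm
  · obtain ⟨W, hW, hv⟩ := exists_finrank_eq_eigenCount T y
    have hd : Disjoint W (Submodule.span ℂ
        (b '' ((Finset.univ.filter fun i => ¬ y < lam i : Finset κ) : Set κ))) := by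
      rw [Submodule.disjoint_def]
      intro v hvW hvS
      by_contra h0
      have h1 := hv v hvW h0
      rw [re_inner_apply_of_eigenbasis b hT, ← b.sum_sq_norm_inner_right v, Finset.mul_sum] at h1
      refine absurd h1 (not_lt.2 (Finset.sum_le_sum fun i _ => ?_))
      by_cases hi : y < lam i
      · rw [inner_eq_zero_of_mem_span_image b hvS (by simpa using hi)]
        simp
      · gcongr
        exact not_lt.1 hi
    have h2 := Submodule.finrank_add_finrank_le_of_disjoint hd
    rw [finrank_span_image, hW, Module.finrank_eq_card_basis b.toBasis] at h2
    have h3 := Finset.card_filter_add_card_filter_not (s := (Finset.univ : Finset κ))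
      (fun i => y < lam i)
    rw [Finset.card_univ] at h3
    omega
  · rw [← finrank_span_image b]
    refine finrank_le_eigenCount fun v hv h0 => ?_
    rw [re_inner_apply_of_eigenbasis b hT, ← b.sum_sq_norm_inner_right v, Finset.mul_sum]
    have hz : ∀ i, ¬ y < lam i → inner ℂ (b i) v = 0 := fun i hi =>
      inner_eq_zero_of_mem_span_image b hv (by simpa using hi)
    refine Finset.sum_lt_sum (fun i _ => ?_) ?_
    · by_cases hi : y < lam i
      · gcongr
      · simp [hz i hi]
    · by_contra! hcon
      refine h0 (b.toBasis.ext_elem_iff.2 fun i => ?_)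
      simp only [OrthonormalBasis.coe_toBasis_repr_apply, b.repr_apply_apply, map_zero,
        Finsupp.coe_zero, Pi.zero_apply]
      by_cases hi : y < lam i
      · by_contra hne
        have := le_of_mul_le_mul_right (hcon i (Finset.mem_univ i))
          (pow_pos (norm_pos_iff.2 hne) 2)
        linarith
      · exact hz i hi

/-- The finite spectrum leaves a gap around `y`; a perturbation smaller than the gap squeezes the
count between those of `T` at `y ± η`, which are equal. -/
theorem exists_eigenCount_eq (b : OrthonormalBasis κ ℂ V) {T : V →L[ℂ] V} {lam : κ → ℝ}
    (hT : ∀ i, T (b i) = (lam i : ℂ) • b i) {y : ℝ} (hy : ∀ i, lam i ≠ y) :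
    ∃ η > 0, ∀ T' : V →L[ℂ] V, ‖T' - T‖ ≤ η → eigenCount T' y = eigenCount T y := by
  obtain ⟨η, hη, hgap⟩ : ∃ η > 0, ∀ i, η < |lam i - y| := by
    have h : ∀ᶠ η : ℝ in 𝓝[>] 0, ∀ i, η < |lam i - y| := by
      refine eventually_all.2 fun i => ?_
      exact nhdsWithin_le_nhds (eventually_lt_nhds (abs_pos.2 (sub_ne_zero.2 (hy i))))
    obtain ⟨η, h1, h2⟩ := (h.and self_mem_nhdsWithin).exists
    exact ⟨η, h2, h1⟩
  refine ⟨η, hη, fun T' hT' => ?_⟩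
  have h1 := eigenCount_add_le hT' (y - η)
  have h2 := eigenCount_add_le (by rwa [norm_sub_rev] at hT' : ‖T - T'‖ ≤ η) y
  rw [sub_add_cancel] at h1
  have h3 : eigenCount T (y - η) = eigenCount T y := by
    rw [eigenCount_eq_card b hT, eigenCount_eq_card b hT]
    congr 1
    ext i
    have := hgap i
    simp only [Finset.mem_filter, Finset.mem_univ, true_and]
    rw [lt_abs] at this
    constructor <;> intro h <;> rcases this with h' | h' <;> linarith
  have h4 : eigenCount T (y + η) = eigenCount T y := by
    rw [eigenCount_eq_card b hT, eigenCount_eq_card b hT]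
    congr 1
    ext i
    have := hgap i
    simp only [Finset.mem_filter, Finset.mem_univ, true_and]
    rw [lt_abs] at this
    constructor <;> intro h <;> rcases this with h' | h' <;> linarith
  omega

theorem exists_eigenbasis {T : V →L[ℂ] V} (hT : IsSelfAdjoint T) :
    ∃ (b : OrthonormalBasis (Fin (Module.finrank ℂ V)) ℂ V) (lam : Fin (Module.finrank ℂ V) → ℝ),
      ∀ i, T (b i) = (lam i : ℂ) • b i := by
  have hs : (T : V →ₗ[ℂ] V).IsSymmetric := ContinuousLinearMap.isSelfAdjoint_iff_isSymmetric.1 hT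
  exact ⟨hs.eigenvectorBasis rfl, hs.eigenvalues rfl, fun i => hs.apply_eigenvectorBasis rfl i⟩

theorem eventually_eigenCount_eq_of_eigenbasis {X : Type*} [TopologicalSpace X]
    {T : X → V →L[ℂ] V} (hc : Continuous T) {x : X} (b : OrthonormalBasis κ ℂ V) {lam : κ → ℝ}
    (hb : ∀ i, T x (b i) = (lam i : ℂ) • b i) {y : ℝ} (hy : ∀ i, lam i ≠ y) :
    ∀ᶠ x' in 𝓝 x, eigenCount (T x') y = eigenCount (T x) y := by
  obtain ⟨η, hη, h⟩ := exists_eigenCount_eq b hb hy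
  have h1 := hc.continuousAt (x := x) (Metric.closedBall_mem_nhds (T x) hη)
  filter_upwards [h1] with x' hx'
  exact h _ (by simpa [dist_eq_norm] using hx')

/-- Along a continuous path, the number of eigenvalues above `y` can only change at a parameter
where `y` is an eigenvalue. -/
theorem eventually_eigenCount_eq {X : Type*} [TopologicalSpace X] {T : X → V →L[ℂ] V}
    (hc : Continuous T) (hs : ∀ x, IsSelfAdjoint (T x)) {y : ℝ} (x : X)
    (hu : ∀ v, T x v = (y : ℂ) • v → v = 0) :
    ∀ᶠ x' in 𝓝 x, eigenCount (T x') y = eigenCount (T x) y := by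
  obtain ⟨b, lam, hb⟩ := exists_eigenbasis (hs x)
  refine eventually_eigenCount_eq_of_eigenbasis hc b hb fun i hi => ?_
  exact b.orthonormal.ne_zero i (hu (b i) (by rw [hb, hi]))

end EigenCount

/-- Two increasing tuples with `δ`-close counting functions are `δ`-close. -/
theorem le_add_of_card_filter_le {n : ℕ} {x x' : Fin n → ℝ} (hx : Monotone x) (hx' : Monotone x')
    {δ : ℝ} (h : ∀ y ∈ Set.range x', (Finset.univ.filter fun j => y + δ < x j).card ≤
      (Finset.univ.filter fun j => y < x' j).card) (j : Fin n) : x j ≤ x' j + δ := by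
  by_contra! hj
  have h1 := h (x' j) ⟨j, rfl⟩
  -- At level `x' j`, at least the `n - j` indices from `j` on are counted for `x`, but at most the
  -- `n - j - 1` indices after `j` for `x'`.
  have h2 : Finset.Ici j ⊆ Finset.univ.filter fun i => x' j + δ < x i := fun i hi => by
    simp only [Finset.mem_Ici] at hi
    simpa using hj.trans_le (hx hi)
  have h3 : (Finset.univ.filter fun i => x' j < x' i) ⊆ Finset.Ioi j := fun i hi => by
    simp only [Finset.mem_filter, Finset.mem_univ, true_and] at hi
    rw [Finset.mem_Ioi]
    by_contra! hle
    exact absurd (hx' hle) (not_le.2 hi)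
  have h4 := Finset.card_le_card h2
  have h5 := Finset.card_le_card h3
  rw [Fin.card_Ici] at h4
  rw [Fin.card_Ioi] at h5
  omega

/-! ### Consequences of real rank zero. -/

section RealRank

/-- The values are removed from the spectrum one at a time: invertibility is an open condition, so a
small enough further perturbation keeps the values already removed. -/
theorem UnitalRealRankZero.exists_isUnit_sub {B : Type*} [CStarAlgebra B]
    (h : UnitalRealRankZero B) (Λ : Finset ℝ) {a : B} (ha : IsSelfAdjoint a) {ε : ℝ}
    (hε : 0 < ε) :
    ∃ b : B, IsSelfAdjoint b ∧ ‖b - a‖ < ε ∧ ∀ l ∈ Λ, IsUnit (b - algebraMap ℂ B (l : ℂ)) := by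
  classical
  induction Λ using Finset.induction_on with
  | empty => exact ⟨a, ha, by simpa using hε, by simp⟩
  | insert l Λ hl ih =>
    obtain ⟨b, hb, hba, hu⟩ := ih
    have hsl : IsSelfAdjoint (algebraMap ℂ B (l : ℂ)) := by
      rw [IsSelfAdjoint, ← algebraMap_star_comm]
      simp
    have hopen : ∀ᶠ c in 𝓝 b, ‖c - a‖ < ε ∧ ∀ l ∈ Λ, IsUnit (c - algebraMap ℂ B (l : ℂ)) := by
      refine Filter.Eventually.and ?_ ((Filter.eventually_all_finset _).2 fun l' hl' => ?_)
      · exact ((continuous_id.sub continuous_const).norm.continuousAt (x := b)).eventually_lt_const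
          hba
      · exact ((continuous_id.sub continuous_const).continuousAt (x := b)).eventually
          (Units.isOpen.mem_nhds (hu l' hl'))
    have hcl := h (hb.sub hsl : b - algebraMap ℂ B (l : ℂ) ∈ {b : B | IsSelfAdjoint b})
    have hev : ∀ᶠ d in 𝓝 (b - algebraMap ℂ B (l : ℂ)),
        ‖d + algebraMap ℂ B (l : ℂ) - a‖ < ε ∧
          ∀ l' ∈ Λ, IsUnit (d + algebraMap ℂ B (l : ℂ) - algebraMap ℂ B (l' : ℂ)) := by
      have hc : ContinuousAt (fun d : B => d + algebraMap ℂ B (l : ℂ))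
          (b - algebraMap ℂ B (l : ℂ)) := by fun_prop
      rw [ContinuousAt, sub_add_cancel] at hc
      exact hc.eventually hopen
    obtain ⟨d, ⟨hd1, hd2⟩, hd3, hd4⟩ := mem_closure_iff_nhds.1 hcl _ hev
    refine ⟨d + algebraMap ℂ B (l : ℂ), hd3.add hsl, hd1, fun l' hl' => ?_⟩
    rcases Finset.mem_insert.1 hl' with rfl | hl'
    · simpa using hd4
    · exact hd2 l' hl'

/-! ### Point evaluations as representations. -/

section Eval

variable {k : ℕ} {p : Fin k → Params}

/-- Evaluation of a finite direct sum of dimension drop algebras at a point of a summand. -/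
noncomputable def evalHom (p : Fin k → Params) (i : Fin k) (s : unitInterval) :
    FinSum p →⋆ₙₐ[ℂ] Matrix (Fin (p i).m) (Fin (p i).m) ℂ where
  toFun f := (f i).1 s
  map_smul' _ _ := rfl
  map_zero' := rfl
  map_add' _ _ := rfl
  map_mul' _ _ := rfl
  map_star' _ := rfl

theorem evalHom_apply (i : Fin k) (s : unitInterval) (f : FinSum p) :
    evalHom p i s f = (f i).1 s := rfl

/-- Evaluation at a point, as a representation on a Euclidean space. -/
noncomputable def evalRep (p : Fin k → Params) (i : Fin k) (s : unitInterval) :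
    FinSum p →⋆ₙₐ[ℂ] (EuclideanSpace ℂ (Fin (p i).m) →L[ℂ] EuclideanSpace ℂ (Fin (p i).m)) :=
  NonUnitalStarAlgHom.comp
    ((Matrix.toEuclideanCLM (𝕜 := ℂ) (n := Fin (p i).m) :
      Matrix (Fin (p i).m) (Fin (p i).m) ℂ →⋆ₙₐ[ℂ] _)) (evalHom p i s)

theorem evalRep_apply (i : Fin k) (s : unitInterval) (f : FinSum p) :
    evalRep p i s f = Matrix.toEuclideanCLM (𝕜 := ℂ) ((f i).1 s) := rfl

theorem norm_evalRep_le (i : Fin k) (s : unitInterval) (f : FinSum p) :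
    ‖evalRep p i s f‖ ≤ ‖f‖ := by
  rw [evalRep_apply, ← Matrix.cstar_norm_def]
  exact ((f i).1.norm_coe_le_norm s).trans (norm_le_pi_norm f i)

theorem continuous_evalRep (i : Fin k) (f : FinSum p) :
    Continuous fun s => evalRep p i s f := by
  have h : Continuous fun M : Matrix (Fin (p i).m) (Fin (p i).m) ℂ =>
      Matrix.toEuclideanCLM (𝕜 := ℂ) M := by
    refine AddMonoidHomClass.continuous_of_bound (Matrix.toEuclideanCLM (𝕜 := ℂ)) 1 fun M => ?_
    rw [one_mul, Matrix.cstar_norm_def]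
  exact h.comp (f i).1.continuous

end Eval

/-! ### From the limit back to finite stages. -/

section Limit

variable {D : ℕ → Type*} [∀ n, NonUnitalCStarAlgebra (D n)]
  {ν : ∀ n m, n ≤ m → (D n →⋆ₙₐ[ℂ] D m)}
  {A : Type*} [NonUnitalCStarAlgebra A] {ι : ∀ n, D n →⋆ₙₐ[ℂ] A}

theorem IsInductiveLimit.exists_norm_lt
    (hA : IsInductiveLimit ν ι) {n : ℕ} {a : D n} {c : ℝ}
    (h : ‖ι n a‖ < c) : ∃ r₀, n ≤ r₀ ∧ ∀ r (hr : n ≤ r), r₀ ≤ r → ‖ν n r hr a‖ < c := by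
  have h1 := (hA.norm_eq n a).eventually_lt_const h
  obtain ⟨⟨r₀, h0⟩, h2⟩ := eventually_atTop.1 h1
  exact ⟨r₀, h0, fun r hr hr0 => h2 ⟨r, hr⟩ hr0⟩

theorem IsInductiveLimit.exists_norm_sub_lt
    (hA : IsInductiveLimit ν ι) (a : A) {ε : ℝ} (hε : 0 < ε)
    (n : ℕ) : ∃ r, n ≤ r ∧ ∃ b : D r, ‖ι r b - a‖ < ε := by
  obtain ⟨x, hx, hxa⟩ := hA.dense.exists_dist_lt a hε
  obtain ⟨r, b, rfl⟩ := Set.mem_iUnion.1 hx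
  refine ⟨max n r, le_max_left _ _, ν r (max n r) (le_max_right _ _) b, ?_⟩
  rw [hA.compatible]
  rwa [dist_comm, dist_eq_norm] at hxa

theorem unitization_mul_eq_one {A : Type*} [NonUnitalRing A] [Module ℂ A] [IsScalarTower ℂ A A]
    [SMulCommClass ℂ A A] {z : ℂ} {c : A} {e : Unitization ℂ A}
    (he : e * (algebraMap ℂ (Unitization ℂ A) z + (c : Unitization ℂ A)) = 1) :
    e.fst * z = 1 ∧ e.fst • c + z • e.snd + e.snd * c = 0 := by
  rw [Unitization.algebraMap_eq_inl] at he
  have h1 := congrArg (fun x : Unitization ℂ A => x.fst) he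
  have h2 := congrArg (fun x : Unitization ℂ A => x.snd) he
  simp only [Unitization.fst_mul, Unitization.fst_add, Unitization.fst_inl, Unitization.fst_inr,
    Unitization.fst_one, Unitization.snd_mul, Unitization.snd_add, Unitization.snd_inl,
    Unitization.snd_inr, Unitization.snd_one, add_zero, zero_add] at h1 h2
  exact ⟨h1, h2⟩

/-- Neumann series: `(w + φ c') (z + φ c)` differs from `1` by exactly `φ (w • c + z • c' + c' *
c)`. The error term lives in the non-unital algebra, so `φ` need not respect any unit. -/
theorem exists_left_inv_of_norm_map_lt_one {C B : Type*} [NonUnitalRing C] [Module ℂ C]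
    [NormedRing B] [NormedAlgebra ℂ B] [CompleteSpace B]
    (φ : C →ₙₐ[ℂ] B) {c c' : C} {z w : ℂ} (hwz : w * z = 1)
    (h : ‖φ (w • c + z • c' + c' * c)‖ < 1) : ∃ b, b * (algebraMap ℂ B z + φ c) = 1 := by
  have h7 := isUnit_one_sub_of_norm_lt_one (by rwa [← norm_neg] at h)
  have h8 : (algebraMap ℂ B w + φ c') * (algebraMap ℂ B z + φ c) =
      1 - -φ (w • c + z • c' + c' * c) := by
    rw [map_add, map_add, map_smul, map_smul, map_mul, add_mul, mul_add, mul_add, ← map_mul, hwz,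
      map_one, ← Algebra.commutes z, ← Algebra.smul_def, ← Algebra.smul_def]
    abel
  rw [← h8] at h7
  obtain ⟨b, hb⟩ := h7.exists_left_inv
  exact ⟨_, (mul_assoc _ _ _).trans hb⟩

/-- The non-scalar part of the inverse in the unitization is approximated by an element `c'` of a
finite stage; the scalar part `w` is kept exactly. -/
theorem IsInductiveLimit.exists_norm_almost_inverse
    (hA : IsInductiveLimit ν ι) {n : ℕ} (c : D n) (z : ℂ)
    (hu : IsUnit (algebraMap ℂ (Unitization ℂ A) z + (ι n c : Unitization ℂ A))) :
    ∃ w : ℂ, w * z = 1 ∧ ∃ R, ∃ hnR : n ≤ R, ∃ c' : D R,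
      ‖ι R (w • ν n R hnR c + z • c' + c' * ν n R hnR c)‖ < 1 := by
  obtain ⟨e, he⟩ := hu.exists_left_inv
  obtain ⟨h1, h2⟩ := unitization_mul_eq_one he
  have hpos : 0 < ‖z‖ + ‖ι n c‖ + 1 := by positivity
  obtain ⟨R, hnR, c', hc'⟩ := hA.exists_norm_sub_lt e.snd (inv_pos.2 hpos) n
  refine ⟨e.fst, h1, R, hnR, c', ?_⟩
  have h4 : ι R (ν n R hnR c) = ι n c := hA.compatible n R hnR c
  have h5 : ι R (e.fst • ν n R hnR c + z • c' + c' * ν n R hnR c) =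
      e.fst • ι R (ν n R hnR c) + z • ι R c' + ι R c' * ι R (ν n R hnR c) := by
    rw [map_add, map_add, map_smul, map_smul, map_mul]
  have h6 : ι R (e.fst • ν n R hnR c + z • c' + c' * ν n R hnR c) =
      z • (ι R c' - e.snd) + (ι R c' - e.snd) * ι n c := by
    rw [h5, h4, smul_sub, sub_mul, ← sub_zero (e.fst • ι n c + _ + _), ← h2]
    abel
  rw [h6]
  calc _ ≤ ‖z‖ * ‖ι R c' - e.snd‖ + ‖ι R c' - e.snd‖ * ‖ι n c‖ := by
        refine (norm_add_le _ _).trans (add_le_add (norm_smul_le _ _) (norm_mul_le _ _))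
    _ ≤ (‖z‖ + ‖ι n c‖ + 1) * ‖ι R c' - e.snd‖ := by nlinarith [norm_nonneg (ι R c' - e.snd)]
    _ < (‖z‖ + ‖ι n c‖ + 1) * (‖z‖ + ‖ι n c‖ + 1)⁻¹ := by gcongr
    _ = 1 := mul_inv_cancel₀ hpos.ne'

/-- Invertibility of `z + ι c` in the unitized limit is visible at a finite stage, in every
representation. -/
theorem IsInductiveLimit.exists_injective
    (hν : IsInductiveSequence ν)
    (hA : IsInductiveLimit ν ι) {n : ℕ} (c : D n) (z : ℂ)
    (hu : IsUnit (algebraMap ℂ (Unitization ℂ A) z + (ι n c : Unitization ℂ A))) :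
    ∃ r₀, ∀ r (hr : n ≤ r), r₀ ≤ r → ∀ {V : Type} [NormedAddCommGroup V] [InnerProductSpace ℂ V]
      [CompleteSpace V] (φ : D r →⋆ₙₐ[ℂ] (V →L[ℂ] V)), (∀ a, ‖φ a‖ ≤ ‖a‖) → ∀ v,
      z • v + φ (ν n r hr c) v = 0 → v = 0 := by
  obtain ⟨w, hwz, R, hnR, c', h3⟩ := hA.exists_norm_almost_inverse c z hu
  obtain ⟨r₀, hr₀, h4⟩ := hA.exists_norm_lt h3
  refine ⟨r₀, fun r hr hrr V _ _ _ φ hφ v hv => ?_⟩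
  have h5 := h4 r (hr₀.trans hrr) hrr
  have h6 := (hφ _).trans_lt h5
  rw [← hν.map_map n R r hnR (hr₀.trans hrr)] at hv
  obtain ⟨b, hb⟩ := exists_left_inv_of_norm_map_lt_one
    (φ.comp (ν R r (hr₀.trans hrr))).toNonUnitalAlgHom hwz h6
  have h7 := congrArg (fun T => T v) hb
  have h8 : b (z • v + φ (ν R r (hr₀.trans hrr) (ν n R hnR c)) v) = v := h7
  rw [← h8, hv, map_zero]

/-- If the limit has real rank zero, then the images of a self-adjoint element can be perturbed,
up to a scalar, so as to avoid finitely many spectral values. -/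
theorem IsInductiveLimit.exists_approx
    (hν : IsInductiveSequence ν) (hA : IsInductiveLimit ν ι) (hrr : RealRankZero A) {n : ℕ}
    {h : D n} (hh : IsSelfAdjoint h) {ε : ℝ} (hε : 0 < ε) (Λ : Finset ℝ) :
    ∃ r₀, ∀ r (hr : n ≤ r), r₀ ≤ r → ∃ (b : D r) (μ : ℝ), IsSelfAdjoint b ∧ |μ| ≤ ε ∧
      ‖b - ν n r hr h‖ ≤ ε ∧ ∀ l ∈ Λ, ∀ {V : Type} [NormedAddCommGroup V]
      [InnerProductSpace ℂ V] [CompleteSpace V] (φ : D r →⋆ₙₐ[ℂ] (V →L[ℂ] V)),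
      (∀ a, ‖φ a‖ ≤ ‖a‖) → ∀ v, ((μ : ℂ) - l) • v + φ b v = 0 → v = 0 := by
  have hsa : IsSelfAdjoint (ι n h : Unitization ℂ A) := (hh.map (ι n)).inr ℂ
  -- Half of `ε` pays for the scalar part `μ` of `b`: the non-scalar part then stays within `ε / 2 +
  -- ε / 2` of `ι n h`.
  obtain ⟨b, hb, hba, hu⟩ := UnitalRealRankZero.exists_isUnit_sub hrr Λ hsa (half_pos hε)
  have hnorm : ∀ x : Unitization ℂ A, ‖x.fst‖ ≤ ‖x‖ := fun x => by
    rw [Unitization.norm_eq_sup]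
    exact le_sup_left
  have hfst : ‖b.fst‖ < ε / 2 := by
    have := hnorm (b - (ι n h : Unitization ℂ A))
    rw [sub_eq_add_neg, Unitization.fst_add, Unitization.fst_neg, Unitization.fst_inr, neg_zero,
      add_zero, ← sub_eq_add_neg] at this
    exact this.trans_lt hba
  obtain ⟨μ, hμ⟩ : ∃ μ : ℝ, b.fst = μ := by
    have h1 : star b.fst = b.fst := by rw [← Unitization.fst_star, hb.star_eq]
    exact ⟨b.fst.re, (Complex.conj_eq_iff_re.1 h1).symm⟩
  have hsnd : IsSelfAdjoint b.snd := by
    rw [IsSelfAdjoint, ← Unitization.snd_star, hb.star_eq]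
  have hb' : b = algebraMap ℂ _ (μ : ℂ) + (b.snd : Unitization ℂ A) := by
    rw [Unitization.algebraMap_eq_inl, ← hμ, Unitization.inl_fst_add_inr_snd_eq]
  have hsnd' : ‖b.snd - ι n h‖ < ε := by
    have h1 : ((b.snd - ι n h : A) : Unitization ℂ A) =
        (b - (ι n h : Unitization ℂ A)) - algebraMap ℂ _ (μ : ℂ) := by
      rw [Unitization.inr_sub, sub_right_comm]
      congr 1
      exact eq_sub_of_add_eq' hb'.symm
    have h2 : ‖algebraMap ℂ (Unitization ℂ A) (μ : ℂ)‖ < ε / 2 := by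
      rw [norm_algebraMap', ← hμ]
      exact hfst
    rw [← Unitization.norm_inr (𝕜 := ℂ), h1]
    linarith [norm_sub_le (b - (ι n h : Unitization ℂ A)) (algebraMap ℂ _ (μ : ℂ))]
  -- All requirements are open in the non-scalar part, so it may be replaced by an element coming
  -- from a finite stage.
  have hev : ∀ᶠ a in 𝓝 b.snd, ‖a - ι n h‖ < ε ∧ ∀ l ∈ Λ,
      IsUnit (algebraMap ℂ _ (μ : ℂ) + (a : Unitization ℂ A) - algebraMap ℂ _ (l : ℂ)) := by
    refine Filter.Eventually.and ?_ ((Filter.eventually_all_finset _).2 fun l hl => ?_)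
    · exact ((continuous_id.sub continuous_const).norm.continuousAt
        (x := b.snd)).eventually_lt_const hsnd'
    · have hc : Continuous fun a : A =>
          algebraMap ℂ _ (μ : ℂ) + (a : Unitization ℂ A) - algebraMap ℂ _ (l : ℂ) :=
        (continuous_const.add (Unitization.isometry_inr (𝕜 := ℂ)).continuous).sub continuous_const
      refine hc.continuousAt.eventually (Units.isOpen.mem_nhds ?_)
      have h1 := hu l hl
      rw [hb'] at h1
      exact h1
  obtain ⟨η, hη, hball⟩ := Metric.eventually_nhds_iff.1 hev
  obtain ⟨R, hnR, c, hc⟩ := hA.exists_norm_sub_lt b.snd hη n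
  -- Taking the real part restores self-adjointness without increasing the distance to the
  -- self-adjoint `b.snd`.
  set d : D R := (2⁻¹ : ℂ) • (c + star c) with hd
  have hdsa : IsSelfAdjoint d := by
    rw [IsSelfAdjoint, hd, star_smul, star_add, star_star, add_comm]
    simp
  have hdc : ‖ι R d - b.snd‖ < η := by
    have h1 : ι R d - b.snd = (2⁻¹ : ℂ) • ((ι R c - b.snd) + star (ι R c - b.snd)) := by
      rw [hd, map_smul, map_add, map_star, star_sub, hsnd.star_eq, smul_add, smul_add, smul_sub,
        smul_sub]
      nth_rewrite 1 [show b.snd = (2⁻¹ : ℂ) • b.snd + (2⁻¹ : ℂ) • b.snd by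
        rw [← add_smul]; norm_num]
      abel
    have h2 := norm_add_le (ι R c - b.snd) (star (ι R c - b.snd))
    rw [norm_star] at h2
    rw [h1, norm_smul, norm_inv, Complex.norm_ofNat]
    linarith
  obtain ⟨hd1, hd2⟩ := hball (by rwa [dist_eq_norm] : dist (ι R d) b.snd < η)
  have hd3 : ‖ι R (d - ν n R hnR h)‖ < ε := by
    rw [map_sub, hA.compatible]
    exact hd1
  obtain ⟨r₁, hr₁, h3⟩ := hA.exists_norm_lt hd3
  have h4 : ∀ l ∈ Λ, ∃ r₀, ∀ r (hr : R ≤ r), r₀ ≤ r → ∀ {V : Type} [NormedAddCommGroup V]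
      [InnerProductSpace ℂ V] [CompleteSpace V] (φ : D r →⋆ₙₐ[ℂ] (V →L[ℂ] V)),
      (∀ a, ‖φ a‖ ≤ ‖a‖) → ∀ v, ((μ : ℂ) - l) • v + φ (ν R r hr d) v = 0 → v = 0 := by
    intro l hl
    refine hA.exists_injective hν d _ ?_
    rw [map_sub, sub_add_eq_add_sub]
    exact hd2 l hl
  choose! g hg using h4
  refine ⟨max r₁ (Λ.sup g), fun r hr hrr => ?_⟩
  have hr1 : r₁ ≤ r := (le_max_left _ _).trans hrr
  have hRr : R ≤ r := hr₁.trans hr1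
  refine ⟨ν R r hRr d, μ, hdsa.map _, ?_, ?_, fun l hl => hg l hl r hRr
    ((Finset.le_sup hl).trans ((le_max_right _ _).trans hrr))⟩
  · rw [← Real.norm_eq_abs, ← Complex.norm_real, ← hμ]
    linarith
  · have := (h3 r hRr hr1).le
    rwa [map_sub, hν.map_map] at this

/-- If the limit has real rank zero, then the numbers of eigenvalues above a given level of the
values of a self-adjoint element become asymptotically constant. -/
theorem IsInductiveLimit.exists_eigenCount_le
    (hν : IsInductiveSequence ν) (hA : IsInductiveLimit ν ι) (hrr : RealRankZero A) {n : ℕ}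
    {h : D n} (hh : IsSelfAdjoint h) {δ : ℝ} (hδ : 0 < δ) :
    ∃ r₀, ∀ r (hr : n ≤ r), r₀ ≤ r → ∀ {V : Type} [NormedAddCommGroup V] [InnerProductSpace ℂ V]
      [FiniteDimensional ℂ V] {X : Type} [TopologicalSpace X] [PreconnectedSpace X]
      (φ : X → D r →⋆ₙₐ[ℂ] (V →L[ℂ] V)), (∀ x a, ‖φ x a‖ ≤ ‖a‖) →
      (∀ a, Continuous fun x => φ x a) → ∀ s t, ∀ y ∈ Set.Icc (0 : ℝ) 2,
      eigenCount (φ s (ν n r hr h)) (y + δ) ≤ eigenCount (φ t (ν n r hr h)) y := by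
  -- Each comparison with the perturbed operator `B` costs `2 * η` (`η` for `b`, `η` for `μ`), and
  -- rounding to the grid of mesh `η` costs another `η`: `5 * η` in all, less than `δ`.
  set η := δ / 8 with hη
  have hη0 : 0 < η := by positivity
  obtain ⟨J, hJ⟩ := exists_nat_gt (4 / η)
  obtain ⟨r₀, h0⟩ := hA.exists_approx hν hrr hh hη0
    ((Finset.range (J + 8)).image fun j : ℕ => (j : ℝ) * η)
  refine ⟨r₀, fun r hr hrr V _ _ _ X _ _ φ hφ hφc s t y hy => ?_⟩
  have := FiniteDimensional.complete ℂ V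
  obtain ⟨b, μ, hb, hμ, hbn, hinj⟩ := h0 r hr hrr
  set B : X → V →L[ℂ] V := fun x => φ x b +
    (μ : ℂ) • (1 : V →L[ℂ] V) with hB
  have hBc : Continuous B := (hφc b).add continuous_const
  have hBs : ∀ x, IsSelfAdjoint (B x) := fun x => by
    refine (hb.map (φ x)).add ?_
    refine IsSelfAdjoint.smul ?_ (IsSelfAdjoint.one _)
    simp [IsSelfAdjoint]
  have hBn : ∀ x, ‖φ x (ν n r hr h) - B x‖ ≤ 2 * η := fun x => by
    have h1 : φ x (ν n r hr h) - B x = -(φ x (b - ν n r hr h)) - (μ : ℂ) • (1 : V →L[ℂ] V) := by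
      rw [map_sub]
      simp only [hB]
      abel
    have h2 : ‖(μ : ℂ) • (1 : V →L[ℂ] V)‖ ≤ η := by
      refine ContinuousLinearMap.opNorm_le_bound _ hη0.le fun v => ?_
      have h3 : ((μ : ℂ) • (1 : V →L[ℂ] V)) v = (μ : ℂ) • v := rfl
      rw [h3, norm_smul, Complex.norm_real, Real.norm_eq_abs]
      gcongr
    rw [h1]
    refine (norm_sub_le _ _).trans ?_
    rw [norm_neg]
    linarith [(hφ x (b - ν n r hr h)).trans hbn]
  have hJη : 4 < J * η := by rwa [div_lt_iff₀ hη0] at hJ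
  -- `j * η` is the first grid point at or above `y + 2 * η`; since `y ≤ 2`, it belongs to the
  -- finite grid being avoided.
  set j := ⌈(y + 2 * η) / η⌉₊ with hj
  have hpos : 0 ≤ (y + 2 * η) / η := div_nonneg (by linarith [hy.1]) hη0.le
  have hj1 : y + 2 * η ≤ j * η := by
    rw [← div_le_iff₀ hη0]
    exact Nat.le_ceil _
  have hj2 : j * η < y + 3 * η := by
    have := Nat.ceil_lt_add_one hpos
    rw [← hj, ← sub_lt_iff_lt_add, lt_div_iff₀ hη0] at this
    linarith
  have hjJ : j ∈ Finset.range (J + 8) := by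
    rw [Finset.mem_range]
    have : (j : ℝ) * η < (J + 8 : ℕ) * η := by
      push_cast
      nlinarith [hy.2]
    exact_mod_cast lt_of_mul_lt_mul_right this hη0.le
  have hconst : eigenCount (B s) (j * η) = eigenCount (B t) (j * η) := by
    have hl : IsLocallyConstant fun x => eigenCount (B x) (j * η) := by
      refine (IsLocallyConstant.iff_eventually_eq _).2 fun x => ?_
      refine eventually_eigenCount_eq hBc hBs x fun v hv => ?_
      refine hinj _ (Finset.mem_image_of_mem _ hjJ) (φ x) (hφ x) v ?_
      have h3 : φ x b v + (μ : ℂ) • v = ((j * η : ℝ) : ℂ) • v := hv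
      rw [sub_smul, ← h3]
      abel
    exact hl.apply_eq_of_preconnectedSpace s t
  calc _ ≤ eigenCount (φ s (ν n r hr h)) (j * η + 2 * η) :=
        eigenCount_anti _ (by linarith)
    _ ≤ eigenCount (B s) (j * η) := eigenCount_add_le (hBn s) _
    _ = eigenCount (B t) (j * η) := hconst
    _ ≤ eigenCount (B t) (y + 2 * η) := eigenCount_anti _ hj1
    _ ≤ _ := eigenCount_add_le (by rw [norm_sub_rev]; exact hBn t) _

end Limit

end RealRank

/-! ### Standard representations and central elements. -/

section Shapes

variable {k : ℕ} (p : Fin k → Params)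

theorem Params.m₀_pos (q : Params) : 0 < q.m₀ := Nat.pos_of_dvd_of_pos q.dvd₀ q.pos

theorem Params.m₁_pos (q : Params) : 0 < q.m₁ := Nat.pos_of_dvd_of_pos q.dvd₁ q.pos

/-- The types of representations out of which every representation of a finite direct sum of
dimension drop algebras can be built: the zero representation, the irreducible representations
at the two ends of a summand, and the evaluations at the points of a summand. -/
inductive Shape (k : ℕ) : Type
  | zero : Shape k
  | left (i : Fin k) : Shape k
  | mid (i : Fin k) : Shape k
  | right (i : Fin k) : Shape k
  deriving DecidableEq, Fintype

/-- The dimension of the representations of a given type. -/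
def Shape.dim : Shape k → ℕ
  | .zero => 1
  | .left i => (p i).m₀
  | .mid i => (p i).m
  | .right i => (p i).m₁

/-- The zero shape is one-dimensional by convention. Positivity makes orthogonal sets of frames
finite and prevents a frame from being orthogonal to itself. -/
theorem Shape.dim_pos (σ : Shape k) : 0 < σ.dim p := by
  cases σ with
  | zero => exact one_pos
  | left i => exact (p i).m₀_pos
  | mid i => exact (p i).pos
  | right i => exact (p i).m₁_pos

/-- The upper left corner `a` of `a ⊗ 1`. -/
def corner {k m : ℕ} (h : k ∣ m) (hm : 0 < m) (M : Matrix (Fin m) (Fin m) ℂ) :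
    Matrix (Fin k) (Fin k) ℂ :=
  M.submatrix (fun i => tensorIndex h (i, ⟨0, Nat.div_pos (Nat.le_of_dvd hm h)
      (Nat.pos_of_dvd_of_pos h hm)⟩))
    (fun i => tensorIndex h (i, ⟨0, Nat.div_pos (Nat.le_of_dvd hm h)
      (Nat.pos_of_dvd_of_pos h hm)⟩))

theorem tensorOne_apply {k m : ℕ} (h : k ∣ m) (a : Matrix (Fin k) (Fin k) ℂ)
    (i j : Fin k × Fin (m / k)) :
    tensorOne h a (tensorIndex h i) (tensorIndex h j) =
      a i.1 j.1 * if i.2 = j.2 then 1 else 0 := by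
  simp [tensorOne, Matrix.kroneckerMap_apply, Matrix.one_apply]

theorem corner_tensorOne {k m : ℕ} (h : k ∣ m) (hm : 0 < m) (a : Matrix (Fin k) (Fin k) ℂ) :
    corner h hm (tensorOne h a) = a := by
  ext i j
  simp [corner, tensorOne_apply]

/-- The representation at the left end of a summand. -/
noncomputable def leftHom (i : Fin k) :
    FinSum p →⋆ₙₐ[ℂ] Matrix (Fin (p i).m₀) (Fin (p i).m₀) ℂ where
  toFun f := corner (p i).dvd₀ (p i).pos ((f i).1 0)
  map_smul' _ _ := rfl
  map_zero' := rfl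
  map_add' _ _ := rfl
  map_mul' f g := by
    obtain ⟨a, ha⟩ := (f i).2.1
    obtain ⟨b, hb⟩ := (g i).2.1
    have h : ((f * g) i).1 0 = (f i).1 0 * (g i).1 0 := rfl
    rw [h, ha, hb, ← tensorOne_mul, corner_tensorOne, corner_tensorOne, corner_tensorOne]
  map_star' f := rfl

theorem tensorOne_leftHom (i : Fin k) (f : FinSum p) :
    tensorOne (p i).dvd₀ (leftHom p i f) = (f i).1 0 := by
  obtain ⟨a, ha⟩ := (f i).2.1
  have h : leftHom p i f = corner (p i).dvd₀ (p i).pos ((f i).1 0) := rfl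
  rw [h, ha, corner_tensorOne]

/-- The representation at the right end of a summand. -/
noncomputable def rightHom (i : Fin k) :
    FinSum p →⋆ₙₐ[ℂ] Matrix (Fin (p i).m₁) (Fin (p i).m₁) ℂ where
  toFun f := corner (p i).dvd₁ (p i).pos ((f i).1 1)
  map_smul' _ _ := rfl
  map_zero' := rfl
  map_add' _ _ := rfl
  map_mul' f g := by
    obtain ⟨a, ha⟩ := (f i).2.2
    obtain ⟨b, hb⟩ := (g i).2.2
    have h : ((f * g) i).1 1 = (f i).1 1 * (g i).1 1 := rfl
    rw [h, ha, hb, ← tensorOne_mul, corner_tensorOne, corner_tensorOne, corner_tensorOne]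
  map_star' f := rfl

theorem tensorOne_rightHom (i : Fin k) (f : FinSum p) :
    tensorOne (p i).dvd₁ (rightHom p i f) = (f i).1 1 := by
  obtain ⟨a, ha⟩ := (f i).2.2
  have h : rightHom p i f = corner (p i).dvd₁ (p i).pos ((f i).1 1) := rfl
  rw [h, ha, corner_tensorOne]

/-- The standard representation of a given type; the point `x` only matters for evaluations. -/
noncomputable def Shape.hom (x : unitInterval) :
    (σ : Shape k) → FinSum p →⋆ₙₐ[ℂ] Matrix (Fin (σ.dim p)) (Fin (σ.dim p)) ℂ
  | .zero => 0
  | .left i => leftHom p i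
  | .mid i => evalHom p i x
  | .right i => rightHom p i

/-- The central element of a finite direct sum of dimension drop algebras given by a scalar
function on one summand. -/
noncomputable def central (i : Fin k) (g : C(unitInterval, ℂ)) : FinSum p :=
  Pi.single i ⟨⟨fun s => algebraMap ℂ (Matrix (Fin (p i).m) (Fin (p i).m) ℂ) (g s),
      (continuous_algebraMap ℂ _).comp g.continuous⟩,
    ⟨algebraMap ℂ _ (g 0), (tensorOne_scalar _ _).symm⟩,
    ⟨algebraMap ℂ _ (g 1), (tensorOne_scalar _ _).symm⟩⟩

variable {p}

theorem finSum_ext {f g : FinSum p} (h : ∀ i s, (f i).1 s = (g i).1 s) : f = g :=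
  funext fun i => Subtype.ext (ContinuousMap.ext (h i))

theorem central_apply_self (i : Fin k) (g : C(unitInterval, ℂ)) (s : unitInterval) :
    (central p i g i).1 s = algebraMap ℂ _ (g s) := by
  simp [central]

theorem central_apply_of_ne {i j : Fin k} (h : j ≠ i) (g : C(unitInterval, ℂ)) :
    central p i g j = 0 := by
  simp [central, h]

theorem central_mul_apply_self (i : Fin k) (g : C(unitInterval, ℂ)) (f : FinSum p)
    (s : unitInterval) : ((central p i g * f) i).1 s = g s • (f i).1 s := by
  have : ((central p i g * f) i).1 s = (central p i g i).1 s * (f i).1 s := rfl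
  rw [this, central_apply_self, Algebra.smul_def]

theorem central_mul_apply_of_ne {i j : Fin k} (h : j ≠ i) (g : C(unitInterval, ℂ))
    (f : FinSum p) : (central p i g * f) j = 0 := by
  rw [Pi.mul_apply, central_apply_of_ne h, zero_mul]

theorem central_mul_comm (i : Fin k) (g : C(unitInterval, ℂ)) (f : FinSum p) :
    central p i g * f = f * central p i g := by
  refine finSum_ext fun j s => ?_
  by_cases h : j = i
  · subst h
    have : ((f * central p j g) j).1 s = (f j).1 s * (central p j g j).1 s := rfl
    rw [central_mul_apply_self, this, central_apply_self, ← Algebra.commutes, Algebra.smul_def]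
  · rw [central_mul_apply_of_ne h, Pi.mul_apply, central_apply_of_ne h, mul_zero]

theorem central_mul_central (i : Fin k) (g g' : C(unitInterval, ℂ)) :
    central p i g * central p i g' = central p i (g * g') := by
  refine finSum_ext fun j s => ?_
  by_cases h : j = i
  · subst h
    rw [central_mul_apply_self, central_apply_self, central_apply_self, Algebra.smul_def,
      ← map_mul]
    rfl
  · rw [central_mul_apply_of_ne h, central_apply_of_ne h]

theorem central_add (i : Fin k) (g g' : C(unitInterval, ℂ)) :
    central p i (g + g') = central p i g + central p i g' := by
  refine finSum_ext fun j s => ?_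
  by_cases h : j = i
  · subst h
    have : ((central p j g + central p j g') j).1 s =
      (central p j g j).1 s + (central p j g' j).1 s := rfl
    rw [this, central_apply_self, central_apply_self, central_apply_self, ← map_add]
    rfl
  · rw [Pi.add_apply, central_apply_of_ne h, central_apply_of_ne h, central_apply_of_ne h,
      add_zero]

theorem central_smul (i : Fin k) (c : ℂ) (g : C(unitInterval, ℂ)) :
    central p i (c • g) = c • central p i g := by
  refine finSum_ext fun j s => ?_
  by_cases h : j = i
  · subst h
    have : ((c • central p j g) j).1 s = c • (central p j g j).1 s := rfl
    rw [this, central_apply_self, central_apply_self, Algebra.smul_def, ← map_mul]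
    rfl
  · rw [Pi.smul_apply, central_apply_of_ne h, central_apply_of_ne h, smul_zero]

theorem sum_central_one_mul (f : FinSum p) : ∑ i, central p i 1 * f = f := by
  refine funext fun j => ?_
  rw [Finset.sum_apply, Finset.sum_eq_single j]
  · refine Subtype.ext (ContinuousMap.ext fun s => ?_)
    rw [central_mul_apply_self]
    exact one_smul _ _
  · intro i _ h
    exact central_mul_apply_of_ne h.symm _ _
  · simp

theorem isSelfAdjoint_central (i : Fin k) {g : C(unitInterval, ℂ)} (hg : IsSelfAdjoint g) :
    IsSelfAdjoint (central p i g) := by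
  refine finSum_ext fun j s => ?_
  by_cases h : j = i
  · subst h
    have h1 : ((star (central p j g)) j).1 s = star ((central p j g j).1 s) := rfl
    have h2 : star (g s) = g s := by
      conv_rhs => rw [← hg.star_eq]
      rfl
    rw [h1, central_apply_self, ← algebraMap_star_comm, h2]
  · rw [Pi.star_apply, central_apply_of_ne h, star_zero]

/-- The element `s ↦ g s • M` of one summand. -/
noncomputable def bump (i : Fin k) (g : C(unitInterval, ℂ))
    (M : Matrix (Fin (p i).m) (Fin (p i).m) ℂ)
    (h0 : ∃ a, g 0 • M = tensorOne (p i).dvd₀ a) (h1 : ∃ a, g 1 • M = tensorOne (p i).dvd₁ a) :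
    FinSum p :=
  Pi.single i ⟨⟨fun s => g s • M, g.continuous.smul continuous_const⟩, h0, h1⟩

theorem bump_apply (i : Fin k) (g : C(unitInterval, ℂ)) (M : Matrix (Fin (p i).m) (Fin (p i).m) ℂ)
    (h0 : ∃ a, g 0 • M = tensorOne (p i).dvd₀ a) (h1 : ∃ a, g 1 • M = tensorOne (p i).dvd₁ a)
    (s : unitInterval) : (bump i g M h0 h1 i).1 s = g s • M := by
  simp [bump]

theorem tensorOne_zero {k m : ℕ} (h : k ∣ m) : tensorOne h 0 = 0 := by
  simpa using tensorOne_scalar h 0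

theorem leftHom_surjective (i : Fin k) : Function.Surjective (leftHom p i) := fun a => by
  refine ⟨bump i ⟨fun s => 1 - (s : ℂ), by fun_prop⟩ (tensorOne (p i).dvd₀ a) ⟨a, by simp⟩
    ⟨0, by simp [tensorOne_zero]⟩, ?_⟩
  have h : ∀ f : FinSum p, leftHom p i f = corner (p i).dvd₀ (p i).pos ((f i).1 0) := fun _ => rfl
  rw [h, bump_apply]
  simp [corner_tensorOne]

theorem rightHom_surjective (i : Fin k) : Function.Surjective (rightHom p i) := fun a => by
  refine ⟨bump i ⟨fun s => (s : ℂ), by fun_prop⟩ (tensorOne (p i).dvd₁ a)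
    ⟨0, by simp [tensorOne_zero]⟩ ⟨a, by simp⟩, ?_⟩
  have h : ∀ f : FinSum p, rightHom p i f = corner (p i).dvd₁ (p i).pos ((f i).1 1) := fun _ => rfl
  rw [h, bump_apply]
  simp [corner_tensorOne]

theorem evalHom_surjective (i : Fin k) {x : unitInterval} (h0 : x ≠ 0) (h1 : x ≠ 1) :
    Function.Surjective (evalHom p i x) := fun a => by
  have hx0 : (x : ℂ) ≠ 0 := by
    simpa using h0
  have hx1 : (1 : ℂ) - x ≠ 0 := by
    rw [sub_ne_zero]
    intro h
    exact h1 (Subtype.ext (by exact_mod_cast h.symm))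
  refine ⟨bump i ⟨fun s => s * (1 - (s : ℂ)), by fun_prop⟩ ((x * (1 - (x : ℂ)))⁻¹ • a)
    ⟨0, by simp [tensorOne_zero]⟩ ⟨0, by simp [tensorOne_zero]⟩, ?_⟩
  rw [evalHom_apply, bump_apply, smul_smul]
  have : (x : ℂ) * (1 - x) * (x * (1 - (x : ℂ)))⁻¹ = 1 :=
    mul_inv_cancel₀ (mul_ne_zero hx0 hx1)
  exact (congrArg (· • a) this).trans (one_smul _ _)

end Shapes

/-! ### Orthogonal frames carrying a matrix representation. -/

section Frames

variable {V : Type*} [NormedAddCommGroup V] [InnerProductSpace ℂ V] [CompleteSpace V]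
  {D : Type*} [NonUnitalNonAssocSemiring D] [DistribMulAction ℂ D] [Star D]

/-- An orthonormal family on which `Φ` acts through the matrix representation `π`. -/
structure IsFrame (Φ : D →⋆ₙₐ[ℂ] (V →L[ℂ] V)) {d : ℕ}
    (π : D →⋆ₙₐ[ℂ] Matrix (Fin d) (Fin d) ℂ) (w : Fin d → V) : Prop where
  orthonormal : Orthonormal ℂ w
  apply : ∀ f l, Φ f (w l) = ∑ l', π f l' l • w l'

theorem inner_rep_apply (Φ : D →⋆ₙₐ[ℂ] (V →L[ℂ] V)) (f : D) (v w : V) :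
    inner ℂ (Φ f v) w = inner ℂ v (Φ (star f) w) := by
  rw [map_star, ContinuousLinearMap.star_eq_adjoint, ContinuousLinearMap.adjoint_inner_right]

theorem rep_mul_apply (Φ : D →⋆ₙₐ[ℂ] (V →L[ℂ] V)) (f g : D) (v : V) :
    Φ (f * g) v = Φ f (Φ g v) := by
  rw [map_mul]
  rfl

/-- A nondegenerate invariant subspace on which `Φ` factors through a surjection onto a matrix
algebra contains a frame. -/
theorem exists_isFrame_of_ker (Φ : D →⋆ₙₐ[ℂ] (V →L[ℂ] V)) {d : ℕ}
    (π : D →⋆ₙₐ[ℂ] Matrix (Fin d) (Fin d) ℂ) (hπ : Function.Surjective π)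
    (W : Submodule ℂ V) (hW : ∀ f, ∀ v ∈ W, Φ f v ∈ W)
    (hker : ∀ f g, π f = π g → ∀ v ∈ W, Φ f v = Φ g v) {g : D} {v : V} (hv : v ∈ W)
    (hg : Φ g v ≠ 0) :
    ∃ w : Fin d → V, IsFrame Φ π w ∧ ∀ l, w l ∈ W := by
  -- The `u a b` lift the matrix units and multiply like them on `W`. A unit vector fixed by one
  -- diagonal unit `u b b` is moved around by the column `u l b` to give the frame.
  choose u hu using fun a b : Fin d => hπ (Matrix.single a b 1)
  have hk : ∀ {x}, x ∈ W → ∀ {f g}, π f = π g → Φ f x = Φ g x := fun {x} hx f g h =>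
    hker f g h x hx
  obtain ⟨b, hb⟩ : ∃ b, Φ (u b b) v ≠ 0 := by
    by_contra! hcon
    have h1 : Φ g v = Φ (∑ b, g * u b b) v := by
      refine hk hv ?_
      rw [map_sum]
      simp only [map_mul, hu]
      rw [← Finset.mul_sum, Matrix.sum_single_one, mul_one]
    refine hg (h1.trans ?_)
    rw [map_sum, _root_.sum_apply]
    refine Finset.sum_eq_zero fun b _ => ?_
    rw [rep_mul_apply, hcon b, map_zero]
  set w₀ : V := ((‖Φ (u b b) v‖⁻¹ : ℝ) : ℂ) • Φ (u b b) v with hw₀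
  have hw₀W : w₀ ∈ W := W.smul_mem _ (hW _ _ hv)
  have hw₀n : ‖w₀‖ = 1 := by
    rw [hw₀, norm_smul, Complex.norm_real, norm_inv, norm_norm,
      inv_mul_cancel₀ (norm_ne_zero_iff.2 hb)]
  have hw₀b : Φ (u b b) w₀ = w₀ := by
    rw [hw₀, map_smul, ← rep_mul_apply]
    congr 1
    refine hk hv ?_
    rw [map_mul, hu, Matrix.single_mul_single_same, mul_one]
  refine ⟨fun l => Φ (u l b) w₀, ⟨?_, ?_⟩, fun l => hW _ _ hw₀W⟩
  · rw [orthonormal_iff_ite]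
    intro l l'
    rw [inner_rep_apply, ← rep_mul_apply]
    have h1 : π (star (u l b) * u l' b) = π (if l = l' then u b b else 0) := by
      rw [map_mul, map_star, hu, hu, Matrix.star_eq_conjTranspose, Matrix.conjTranspose_single,
        star_one]
      split_ifs with h
      · rw [h, Matrix.single_mul_single_same, mul_one, hu]
      · rw [Matrix.single_mul_single_of_ne _ _ _ _ h, map_zero]
    rw [hk hw₀W h1]
    split_ifs with h
    · rw [hw₀b, inner_self_eq_norm_sq_to_K, hw₀n]
      simp
    · simp
  · intro f l
    rw [← rep_mul_apply]
    have h1 : π (f * u l b) = π (∑ l', π f l' l • u l' b) := by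
      rw [map_sum, map_mul, hu]
      ext i j
      rw [Matrix.sum_apply, Finset.sum_eq_single i]
      · rw [map_smul, hu, Matrix.smul_apply]
        by_cases hj : b = j
        · subst hj
          simp
        · rw [Matrix.single_apply_of_col_ne _ _ hj, smul_zero,
            Matrix.mul_single_apply_of_ne _ _ _ _ _ (Ne.symm hj)]
      · intro l' _ hl'
        rw [map_smul, hu, Matrix.smul_apply, Matrix.single_apply_of_row_ne hl', smul_zero]
      · simp
    rw [hk hw₀W h1, map_sum, _root_.sum_apply]
    simp only [map_smul]
    rfl

theorem exists_isFrame_zero (Φ : D →⋆ₙₐ[ℂ] (V →L[ℂ] V)) {π : D →⋆ₙₐ[ℂ] Matrix (Fin 1) (Fin 1) ℂ}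
    (hπ : ∀ f, π f = 0) {W : Submodule ℂ V} (hW : W ≠ ⊥) (h : ∀ f, ∀ v ∈ W, Φ f v = 0) :
    ∃ w : Fin 1 → V, IsFrame Φ π w ∧ ∀ l, w l ∈ W := by
  obtain ⟨v, hv, h0⟩ := Submodule.exists_mem_ne_zero_of_ne_bot hW
  have h1 : ((‖v‖⁻¹ : ℝ) : ℂ) • v ∈ W := W.smul_mem _ hv
  refine ⟨fun _ => ((‖v‖⁻¹ : ℝ) : ℂ) • v, ⟨⟨fun l => ?_, fun l l' hl => ?_⟩, fun f l => ?_⟩,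
    fun _ => h1⟩
  · rw [norm_smul, Complex.norm_real, norm_inv, norm_norm,
      inv_mul_cancel₀ (norm_ne_zero_iff.2 h0)]
  · exact absurd (Subsingleton.elim l l') hl
  · rw [h f _ h1, hπ]
    simp

variable {J : Type*} {d : J → ℕ} {π : ∀ j, D →⋆ₙₐ[ℂ] Matrix (Fin (d j)) (Fin (d j)) ℂ}

/-- Two families of vectors are orthogonal to each other. -/
def FramePerp (F G : Σ j, Fin (d j) → V) : Prop :=
  ∀ l l', inner ℂ (F.2 l) (G.2 l') = 0

omit [CompleteSpace V] in
theorem FramePerp.symm {F G : Σ j, Fin (d j) → V} (h : FramePerp F G) : FramePerp G F :=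
  fun l l' => inner_eq_zero_symm.1 (h l' l)

/-- A set of pairwise orthogonal frames satisfying the condition `Q`. -/
structure IsFrameSet (Φ : D →⋆ₙₐ[ℂ] (V →L[ℂ] V))
    (π : ∀ j, D →⋆ₙₐ[ℂ] Matrix (Fin (d j)) (Fin (d j)) ℂ) (Q : J → Prop)
    (S : Set (Σ j, Fin (d j) → V)) : Prop where
  isFrame : ∀ F ∈ S, IsFrame Φ (π F.1) F.2
  cond : ∀ F ∈ S, Q F.1
  pairwise : S.Pairwise FramePerp

theorem IsFrameSet.exists_maximal {Φ : D →⋆ₙₐ[ℂ] (V →L[ℂ] V)} {Q : J → Prop}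
    {S : Set (Σ j, Fin (d j) → V)} (hS : IsFrameSet Φ π Q S) :
    ∃ T, S ⊆ T ∧ Maximal (IsFrameSet Φ π Q) T := by
  refine zorn_subset_nonempty {S | IsFrameSet Φ π Q S} (fun c hc hch _ => ?_) S hS
  refine ⟨⋃₀ c, ⟨?_, ?_, ?_⟩, fun s hs => Set.subset_sUnion_of_mem hs⟩
  · rintro F ⟨s, hs, hF⟩
    exact (hc hs).isFrame F hF
  · rintro F ⟨s, hs, hF⟩
    exact (hc hs).cond F hF
  · exact (Set.pairwise_sUnion hch.directedOn).2 fun s hs => (hc hs).pairwise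

theorem mem_of_maximal_isFrameSet {Φ : D →⋆ₙₐ[ℂ] (V →L[ℂ] V)} {Q : J → Prop}
    {S : Set (Σ j, Fin (d j) → V)} (hS : Maximal (IsFrameSet Φ π Q) S)
    {F : Σ j, Fin (d j) → V} (hF : IsFrame Φ (π F.1) F.2) (hQ : Q F.1)
    (hp : ∀ G ∈ S, G ≠ F → FramePerp F G) : F ∈ S := by
  have h : IsFrameSet Φ π Q (insert F S) := by
    refine ⟨?_, ?_, ?_⟩
    · rintro G (rfl | hG)
      exacts [hF, hS.prop.isFrame G hG]
    · rintro G (rfl | hG)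
      exacts [hQ, hS.prop.cond G hG]
    · refine hS.prop.pairwise.insert fun G hG hne => ?_
      exact ⟨hp G hG hne.symm, (hp G hG hne.symm).symm⟩
  exact hS.le_of_ge h (Set.subset_insert _ _) (Set.mem_insert _ _)

theorem IsFrameSet.orthonormal {Φ : D →⋆ₙₐ[ℂ] (V →L[ℂ] V)} {Q : J → Prop}
    {S : Set (Σ j, Fin (d j) → V)} (hS : IsFrameSet Φ π Q S) :
    Orthonormal ℂ fun a : Σ F : S, Fin (d F.1.1) => a.1.1.2 a.2 := by
  refine ⟨fun a => (hS.isFrame _ a.1.2).orthonormal.norm_eq_one a.2, ?_⟩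
  rintro ⟨F, l⟩ ⟨G, l'⟩ hne
  by_cases h : F = G
  · subst h
    exact (hS.isFrame _ F.2).orthonormal.inner_eq_zero fun h' => hne (congrArg _ h')
  · exact hS.pairwise F.2 G.2 (fun h' => h (Subtype.ext h')) l l'

theorem IsFrameSet.finite [FiniteDimensional ℂ V] {Φ : D →⋆ₙₐ[ℂ] (V →L[ℂ] V)} {Q : J → Prop}
    {S : Set (Σ j, Fin (d j) → V)} (hS : IsFrameSet Φ π Q S) (hd : ∀ j, 0 < d j) : S.Finite := by
  have h1 : Finite (Σ F : S, Fin (d F.1.1)) :=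
    hS.orthonormal.linearIndependent.finite
  exact Set.finite_coe_iff.1
    (Finite.of_surjective (fun a : Σ F : S, Fin (d F.1.1) => a.1) fun F => ⟨⟨F, ⟨0, hd _⟩⟩, rfl⟩)

/-- If every nonzero invariant subspace contains a frame, then a maximal set of pairwise
orthogonal frames spans the whole space. -/
theorem span_eq_top_of_maximal [FiniteDimensional ℂ V] {Φ : D →⋆ₙₐ[ℂ] (V →L[ℂ] V)}
    (hd : ∀ j, 0 < d j)
    (hex : ∀ W : Submodule ℂ V, W ≠ ⊥ → (∀ f, ∀ v ∈ W, Φ f v ∈ W) →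
      ∃ (j : J) (w : Fin (d j) → V), IsFrame Φ (π j) w ∧ ∀ l, w l ∈ W)
    {S : Set (Σ j, Fin (d j) → V)} (hS : Maximal (IsFrameSet Φ π fun _ => True) S) :
    Submodule.span ℂ (Set.range fun a : Σ F : S, Fin (d F.1.1) => a.1.1.2 a.2) = ⊤ := by
  set K := Submodule.span ℂ (Set.range fun a : Σ F : S, Fin (d F.1.1) => a.1.1.2 a.2) with hK
  have hKmem : ∀ F ∈ S, ∀ l, F.2 l ∈ K := fun F hF l =>
    Submodule.subset_span ⟨⟨⟨F, hF⟩, l⟩, rfl⟩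
  have hKinv : ∀ f, ∀ v ∈ K, Φ f v ∈ K := by
    intro f v hv
    induction hv using Submodule.span_induction with
    | mem x hx =>
      obtain ⟨⟨F, l⟩, rfl⟩ := hx
      simp only
      rw [(hS.prop.isFrame _ F.2).apply]
      exact Submodule.sum_mem _ fun l' _ => Submodule.smul_mem _ _ (hKmem _ F.2 _)
    | zero => rw [map_zero]; exact zero_mem _
    | add x y _ _ hx hy => rw [map_add]; exact add_mem hx hy
    | smul c x _ hx => rw [map_smul]; exact Submodule.smul_mem _ _ hx
  by_contra hne
  have hbot : Kᗮ ≠ ⊥ := fun h => hne ((Submodule.orthogonal_eq_bot_iff).1 h)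
  -- The orthogonal complement is invariant because `Φ` preserves adjoints. A frame inside it could
  -- be added to `S`, so by maximality it lies in `S` and is orthogonal to itself.
  obtain ⟨j, w, hw, hwK⟩ := hex Kᗮ hbot fun f v hv => by
    rw [Submodule.mem_orthogonal'] at hv ⊢
    intro u hu
    rw [inner_rep_apply]
    exact hv _ (hKinv _ _ hu)
  have hmem := mem_of_maximal_isFrameSet hS (F := ⟨j, w⟩) hw trivial fun G hG _ l l' =>
    Submodule.inner_left_of_mem_orthogonal (hKmem G hG l') (hwK l)
  have h0 : inner ℂ (w ⟨0, hd j⟩) (w ⟨0, hd j⟩) = 0 :=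
    Submodule.inner_left_of_mem_orthogonal (hKmem _ hmem ⟨0, hd j⟩) (hwK _)
  exact hw.orthonormal.ne_zero _ (inner_self_eq_zero.1 h0)

/-- Frames for the corner `a` of a representation `a ⊗ 1` combine to a frame of the latter. -/
theorem IsFrame.tensor {Φ : D →⋆ₙₐ[ℂ] (V →L[ℂ] V)} {n m : ℕ} (h : n ∣ m)
    {π₀ : D →⋆ₙₐ[ℂ] Matrix (Fin n) (Fin n) ℂ} {π : D →⋆ₙₐ[ℂ] Matrix (Fin m) (Fin m) ℂ}
    (hπ : ∀ f, π f = tensorOne h (π₀ f)) {w : Fin (m / n) → Fin n → V}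
    (hw : ∀ c, IsFrame Φ π₀ (w c)) (hp : ∀ c c', c ≠ c' → ∀ l l', inner ℂ (w c l) (w c' l') = 0) :
    IsFrame Φ π fun a => w ((tensorIndex h).symm a).2 ((tensorIndex h).symm a).1 := by
  refine ⟨⟨fun a => (hw _).orthonormal.norm_eq_one _, fun a b hab => ?_⟩, fun f a => ?_⟩
  · by_cases hc : ((tensorIndex h).symm a).2 = ((tensorIndex h).symm b).2
    · simp only [hc]
      refine (hw _).orthonormal.inner_eq_zero fun h' => hab ?_
      exact (tensorIndex h).symm.injective (Prod.ext h' hc)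
    · exact hp _ _ hc _ _
  · obtain ⟨⟨l, c⟩, rfl⟩ := (tensorIndex h).surjective a
    rw [← (tensorIndex h).sum_comp, Fintype.sum_prod_type]
    simp only [Equiv.symm_apply_apply, hπ, tensorOne_apply]
    rw [(hw c).apply]
    refine Finset.sum_congr rfl fun l' _ => ?_
    rw [Finset.sum_eq_single c]
    · simp
    · intro c' _ hc'
      simp [hc']
    · simp

end Frames

/-! ### Locating standard frames in invariant subspaces. -/

section Decomposition

variable {k : ℕ} {p : Fin k → Params} {V : Type*} [NormedAddCommGroup V] [InnerProductSpace ℂ V]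
  [FiniteDimensional ℂ V]

/-- The function `s ↦ 1 + s` on the unit interval. -/
noncomputable def heightFun : C(unitInterval, ℂ) := ⟨fun s => 1 + (s : ℂ), by fun_prop⟩

theorem heightFun_apply (s : unitInterval) : heightFun s = 1 + (s : ℂ) := rfl

theorem isSelfAdjoint_heightFun : IsSelfAdjoint heightFun := by
  ext s
  simp [heightFun_apply]

theorem norm_central_mul_le {i : Fin k} {g : C(unitInterval, ℂ)} {f : FinSum p} {ε : ℝ}
    (hε : 0 ≤ ε) (h : ∀ s, ‖g s • (f i).1 s‖ ≤ ε) : ‖central p i g * f‖ ≤ ε := by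
  refine (pi_norm_le_iff_of_nonneg hε).2 fun j => ?_
  by_cases hj : j = i
  · subst hj
    refine (ContinuousMap.norm_le _ hε).2 fun s => ?_
    change ‖((central p j g * f) j).1 s‖ ≤ ε
    rw [central_mul_apply_self]
    exact h s
  · rw [central_mul_apply_of_ne hj]
    exact (norm_zero (E := interval (p j))).trans_le hε

omit [FiniteDimensional ℂ V] in
theorem rep_central_mul_eq_zero [CompleteSpace V] {Φ : FinSum p →⋆ₙₐ[ℂ] (V →L[ℂ] V)}
    {i : Fin k} {μ : ℂ} {v : V}
    (h1 : Φ (central p i 1) v = v) (h2 : Φ (central p i heightFun) v = μ • v)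
    (κ : C(unitInterval, ℂ)) : Φ (central p i (κ * (heightFun + (-μ) • 1))) v = 0 := by
  rw [← central_mul_central, rep_mul_apply, central_add, central_smul, map_add, map_smul,
    _root_.add_apply, _root_.smul_apply, h1, h2, neg_smul, add_neg_cancel, map_zero]

omit [FiniteDimensional ℂ V] in
-- Otherwise `heightFun - μ` would be invertible in `C(unitInterval, ℂ)`, and its product with the
-- inverse would both fix and kill `v`.
theorem exists_eq_one_add [CompleteSpace V] {Φ : FinSum p →⋆ₙₐ[ℂ] (V →L[ℂ] V)}
    {i : Fin k} {μ : ℂ} {v : V}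
    (h1 : Φ (central p i 1) v = v) (h2 : Φ (central p i heightFun) v = μ • v) (hv : v ≠ 0) :
    ∃ x : unitInterval, μ = 1 + (x : ℂ) := by
  by_contra! hcon
  have hne : ∀ s : unitInterval, (1 + (s : ℂ)) + (-μ) ≠ 0 := fun s h =>
    hcon s (by linear_combination -h)
  let κ : C(unitInterval, ℂ) := ⟨fun s => ((1 + (s : ℂ)) + (-μ))⁻¹,
    Continuous.inv₀ (by fun_prop) hne⟩
  have h3 : κ * (heightFun + (-μ) • 1) = 1 := by
    ext s
    change ((1 + (s : ℂ)) + (-μ))⁻¹ * ((1 + (s : ℂ)) + (-μ) * 1) = 1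
    rw [mul_one, inv_mul_cancel₀ (hne s)]
  have h4 := rep_central_mul_eq_zero h1 h2 κ
  rw [h3, h1] at h4
  exact hv h4

/-- A bump at `x` of the form `1` minus a multiple of `heightFun - (1 + x)`, so that it acts as the
identity on the eigenvectors of the height at `x`. -/
theorem exists_cutoff (x : unitInterval) {δ : ℝ} (hδ : 0 < δ) :
    ∃ κ : C(unitInterval, ℂ), ∀ s : unitInterval,
      ‖(1 - κ * (heightFun + (-(1 + (x : ℂ))) • 1)) s‖ ≤ 1 ∧
      (δ ≤ dist s x → (1 - κ * (heightFun + (-(1 + (x : ℂ))) • 1)) s = 0) := by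
  have hpos : ∀ s : unitInterval, 0 < max |(s : ℝ) - x| δ := fun s => lt_max_of_lt_right hδ
  let κ : C(unitInterval, ℂ) := ⟨fun s => (((s : ℝ) - x) / max |(s : ℝ) - x| δ ^ 2 : ℝ),
    Complex.continuous_ofReal.comp (Continuous.div (by fun_prop) (by fun_prop)
      fun s => (pow_pos (hpos s) 2).ne')⟩
  refine ⟨κ, fun s => ?_⟩
  have h1 : (1 - κ * (heightFun + (-(1 + (x : ℂ))) • 1)) s =
      ((1 - (((s : ℝ) - x) / max |(s : ℝ) - x| δ) ^ 2 : ℝ) : ℂ) := by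
    change 1 - ((((s : ℝ) - x) / max |(s : ℝ) - x| δ ^ 2 : ℝ) : ℂ) *
      ((1 + (s : ℂ)) + (-(1 + (x : ℂ))) * 1) = _
    rw [div_pow]
    push_cast
    ring
  rw [h1]
  constructor
  · rw [Complex.norm_real, Real.norm_eq_abs, abs_le]
    have h2 : |((s : ℝ) - x) / max |(s : ℝ) - x| δ| ≤ 1 := by
      rw [abs_div, abs_of_pos (hpos s), div_le_one (hpos s)]
      exact le_max_left _ _
    have h3 := (sq_le_one_iff_abs_le_one _).2 h2
    constructor <;> nlinarith [sq_nonneg (((s : ℝ) - x) / max |(s : ℝ) - x| δ)]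
  · intro h
    rw [Subtype.dist_eq, Real.dist_eq] at h
    have h2 : |(s : ℝ) - x| ≠ 0 := (hδ.trans_le h).ne'
    rw [max_eq_left h, div_pow, sq_abs, div_self, sub_self, Complex.ofReal_zero]
    exact pow_ne_zero 2 (abs_ne_zero.1 h2)

omit [FiniteDimensional ℂ V] in
-- Multiplying `f` by a cutoff near `x` does not change `Φ f v`, but makes the norm arbitrarily
-- small because `f` vanishes at `x`.
theorem rep_eq_zero_of_eval_eq_zero [CompleteSpace V] {Φ : FinSum p →⋆ₙₐ[ℂ] (V →L[ℂ] V)}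
    (hΦ : ∀ f, ‖Φ f‖ ≤ ‖f‖) {i : Fin k} {x : unitInterval} {v : V}
    (h1 : Φ (central p i 1) v = v) (h2 : Φ (central p i heightFun) v = (1 + (x : ℂ)) • v)
    {f : FinSum p} (hf : (f i).1 x = 0) : Φ f v = 0 := by
  have key : ∀ ε > 0, ‖Φ f v‖ ≤ ε * ‖v‖ := by
    intro ε hε
    obtain ⟨δ, hδ, hball⟩ :=
      Metric.continuousAt_iff.1 ((f i).1.continuous.continuousAt (x := x)) ε hε
    obtain ⟨κ, hκ⟩ := exists_cutoff x hδ
    set θ : C(unitInterval, ℂ) := 1 - κ * (heightFun + (-(1 + (x : ℂ))) • 1) with hθ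
    have h3 : Φ (central p i θ) v = v := by
      have h4 := rep_central_mul_eq_zero h1 h2 κ
      have h5 : (1 : C(unitInterval, ℂ)) = θ + κ * (heightFun + (-(1 + (x : ℂ))) • 1) := by
        rw [hθ, sub_add_cancel]
      rw [h5, central_add, map_add, _root_.add_apply, h4, add_zero] at h1
      exact h1
    have h6 : Φ f v = Φ (central p i θ * f) v := by
      rw [central_mul_comm, rep_mul_apply, h3]
    rw [h6]
    refine (Φ _).le_of_opNorm_le ((hΦ _).trans (norm_central_mul_le hε.le fun s => ?_)) v
    rcases le_or_gt δ (dist s x) with hs | hs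
    · rw [(hκ s).2 hs, zero_smul, norm_zero]
      exact hε.le
    · have h7 := hball hs
      rw [hf, dist_zero_right] at h7
      rw [norm_smul]
      nlinarith [(hκ s).1, norm_nonneg (θ s), norm_nonneg ((f i).1 s)]
  by_contra hne
  have hv : 0 < ‖Φ f v‖ := norm_pos_iff.2 hne
  have h8 := key (‖Φ f v‖ / (2 * (‖v‖ + 1))) (by positivity)
  have h9 : ‖Φ f v‖ / (2 * (‖v‖ + 1)) * ‖v‖ < ‖Φ f v‖ := by
    rw [div_mul_eq_mul_div, div_lt_iff₀ (by positivity)]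
    nlinarith [norm_nonneg v]
  linarith

omit [FiniteDimensional ℂ V] in
theorem rep_eq_of_eval_eq [CompleteSpace V] {Φ : FinSum p →⋆ₙₐ[ℂ] (V →L[ℂ] V)}
    (hΦ : ∀ f, ‖Φ f‖ ≤ ‖f‖) {i : Fin k} {x : unitInterval} {v : V}
    (h1 : Φ (central p i 1) v = v) (h2 : Φ (central p i heightFun) v = (1 + (x : ℂ)) • v)
    {f g : FinSum p} (hf : (f i).1 x = (g i).1 x) : Φ f v = Φ g v := by
  have h3 : Φ (f + (-1 : ℂ) • g) v = 0 := by
    refine rep_eq_zero_of_eval_eq_zero hΦ h1 h2 ?_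
    change (f i).1 x + (-1 : ℂ) • (g i).1 x = 0
    rw [hf, neg_one_smul, add_neg_cancel]
  rw [map_add, map_smul, _root_.add_apply, _root_.smul_apply, neg_one_smul] at h3
  exact eq_of_sub_eq_zero ((sub_eq_add_neg _ _).trans h3)

/-- On an invariant subspace where a representation does not vanish, one of the "heights" has an
eigenvector. -/
theorem exists_height_eigenvector [CompleteSpace V] {Φ : FinSum p →⋆ₙₐ[ℂ] (V →L[ℂ] V)}
    {W : Submodule ℂ V} (hW : ∀ f, ∀ v ∈ W, Φ f v ∈ W) {f : FinSum p} {w : V} (hw : w ∈ W)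
    (hf : Φ f w ≠ 0) :
    ∃ (i : Fin k) (μ : ℂ), ∃ v ∈ W, v ≠ 0 ∧ Φ (central p i 1) v = v ∧
      Φ (central p i heightFun) v = μ • v := by
  obtain ⟨i, hi⟩ : ∃ i, Φ (central p i 1 * f) w ≠ 0 := by
    by_contra! hcon
    refine hf ?_
    rw [← sum_central_one_mul f, map_sum, _root_.sum_apply]
    exact Finset.sum_eq_zero fun i _ => hcon i
  have hidem : ∀ v, Φ (central p i 1) (Φ (central p i 1) v) = Φ (central p i 1) v := fun v => by
    rw [← rep_mul_apply, central_mul_central, mul_one]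
  -- The part of `W` carried by summand `i`; it is nonzero and stable under the height, which
  -- therefore has an eigenvector there.
  let W₁ : Submodule ℂ V := W ⊓ LinearMap.eqLocus (Φ (central p i 1) : V →ₗ[ℂ] V) LinearMap.id
  have hmem : ∀ v, v ∈ W₁ ↔ v ∈ W ∧ Φ (central p i 1) v = v := fun v => Iff.rfl
  have hinv : ∀ v ∈ W₁, (Φ (central p i heightFun) : V →ₗ[ℂ] V) v ∈ W₁ := fun v hv => by
    obtain ⟨h1, h2⟩ := (hmem v).1 hv
    refine (hmem _).2 ⟨hW _ _ h1, ?_⟩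
    change Φ _ (Φ _ v) = Φ _ v
    rw [← rep_mul_apply, central_mul_central, one_mul]
  have hmem₁ : Φ (central p i 1 * f) w ∈ W₁ := (hmem _).2
    ⟨hW _ _ hw, by rw [rep_mul_apply, hidem]⟩
  have : Nontrivial W₁ := ⟨⟨⟨_, hmem₁⟩, 0, fun h => hi (congrArg Subtype.val h)⟩⟩
  obtain ⟨μ, hμ⟩ := Module.End.exists_eigenvalue
    ((Φ (central p i heightFun) : V →ₗ[ℂ] V).restrict hinv)
  obtain ⟨v, hv⟩ := hμ.exists_hasEigenvector
  obtain ⟨h1, h2⟩ := (hmem v).1 v.2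
  refine ⟨i, μ, v, h1, fun h => hv.2 (Subtype.ext h), h2, ?_⟩
  exact congrArg Subtype.val hv.apply_eq_smul

/-- Every nonzero invariant subspace contains a frame of one of the standard types. -/
theorem exists_isFrame [CompleteSpace V] {Φ : FinSum p →⋆ₙₐ[ℂ] (V →L[ℂ] V)}
    (hΦ : ∀ f, ‖Φ f‖ ≤ ‖f‖) {W : Submodule ℂ V} (hne : W ≠ ⊥) (hW : ∀ f, ∀ v ∈ W, Φ f v ∈ W) :
    ∃ (j : Shape k × unitInterval) (w : Fin (j.1.dim p) → V),
      IsFrame Φ (j.1.hom p j.2) w ∧ ∀ l, w l ∈ W := by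
  by_cases hz : ∀ f, ∀ v ∈ W, Φ f v = 0
  · obtain ⟨w, hw⟩ := exists_isFrame_zero (π := Shape.hom p 0 .zero) Φ (fun _ => rfl) hne hz
    exact ⟨(.zero, 0), w, hw⟩
  push Not at hz
  obtain ⟨f, w, hw, hf⟩ := hz
  obtain ⟨i, μ, v, hv, hv0, h1, h2⟩ := exists_height_eigenvector hW hw hf
  obtain ⟨x, rfl⟩ := exists_eq_one_add h1 h2 hv0
  -- The joint eigenspace is invariant since the two elements are central, and on it `Φ` factors
  -- through evaluation at `x`.
  let W₂ : Submodule ℂ V := W ⊓ (LinearMap.eqLocus (Φ (central p i 1) : V →ₗ[ℂ] V) LinearMap.id ⊓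
    LinearMap.eqLocus (Φ (central p i heightFun) : V →ₗ[ℂ] V) ((1 + (x : ℂ)) • LinearMap.id))
  have hmem : ∀ v, v ∈ W₂ ↔ v ∈ W ∧ Φ (central p i 1) v = v ∧
    Φ (central p i heightFun) v = (1 + (x : ℂ)) • v := fun v => Iff.rfl
  have hW₂ : ∀ f, ∀ v ∈ W₂, Φ f v ∈ W₂ := fun f v hv => by
    obtain ⟨h3, h4, h5⟩ := (hmem v).1 hv
    refine (hmem _).2 ⟨hW _ _ h3, ?_, ?_⟩
    · rw [← rep_mul_apply, central_mul_comm, rep_mul_apply, h4]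
    · rw [← rep_mul_apply, central_mul_comm, rep_mul_apply, h5, map_smul]
  have hker : ∀ f g : FinSum p, (f i).1 x = (g i).1 x →
      ∀ v ∈ W₂, Φ f v = Φ g v := fun f g hf v hv =>
    rep_eq_of_eval_eq hΦ ((hmem v).1 hv).2.1 ((hmem v).1 hv).2.2 hf
  have hvW : v ∈ W₂ := (hmem v).2 ⟨hv, h1, h2⟩
  have hg : Φ (central p i 1) v ≠ 0 := by rwa [h1]
  have hle : ∀ v, v ∈ W₂ → v ∈ W := fun v hv => ((hmem v).1 hv).1
  by_cases hx0 : x = 0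
  · obtain ⟨w, hw, hwW⟩ := exists_isFrame_of_ker Φ (leftHom p i) (leftHom_surjective i) W₂ hW₂
      (fun f g hf => hker f g (by rw [hx0, ← tensorOne_leftHom, hf, tensorOne_leftHom])) hvW hg
    exact ⟨(.left i, 0), w, hw, fun l => hle _ (hwW l)⟩
  by_cases hx1 : x = 1
  · obtain ⟨w, hw, hwW⟩ := exists_isFrame_of_ker Φ (rightHom p i) (rightHom_surjective i) W₂ hW₂
      (fun f g hf => hker f g (by rw [hx1, ← tensorOne_rightHom, hf, tensorOne_rightHom])) hvW hg
    exact ⟨(.right i, 0), w, hw, fun l => hle _ (hwW l)⟩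
  obtain ⟨w, hw, hwW⟩ := exists_isFrame_of_ker Φ (evalHom p i x) (evalHom_surjective i hx0 hx1)
    W₂ hW₂ hker hvW hg
  exact ⟨(.mid i, x), w, hw, fun l => hle _ (hwW l)⟩

end Decomposition

/-! ### Decompositions with reduced end multiplicities. -/

section Decomposition

variable {k : ℕ} {p : Fin k → Params} {V : Type*} [NormedAddCommGroup V] [InnerProductSpace ℂ V]
  [FiniteDimensional ℂ V] [CompleteSpace V]

/-- An orthogonal decomposition of a representation into representations of the standard types,
the type `σ` occurring `n σ` times, with the multiplicities of the representations at the
ends of the summands reduced as far as possible. -/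
structure Decomposition (Φ : FinSum p →⋆ₙₐ[ℂ] (V →L[ℂ] V)) (n : Shape k → ℕ) where
  x : ∀ σ, Fin (n σ) → unitInterval
  monotone : ∀ σ, Monotone (x σ)
  basis : OrthonormalBasis (Σ σ : Shape k, Fin (n σ) × Fin (σ.dim p)) ℂ V
  apply : ∀ f σ j l, Φ f (basis ⟨σ, j, l⟩) =
    ∑ l', σ.hom p (x σ j) f l' l • basis ⟨σ, j, l'⟩
  left_lt : ∀ i, n (.left i) < (p i).m / (p i).m₀
  right_lt : ∀ i, n (.right i) < (p i).m / (p i).m₁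

/-- The index type for the standard representations. -/
abbrev FrameIdx (p : Fin k → Params) (V : Type*) :=
  Σ j : Shape k × unitInterval, Fin (j.1.dim p) → V

/-- The shape-`σ` part of a set of frames. -/
def frameFiber (S : Set (FrameIdx p V)) (σ : Shape k) :
    Set (unitInterval × (Fin (σ.dim p) → V)) :=
  {a | (⟨(σ, a.1), a.2⟩ : FrameIdx p V) ∈ S}

omit [NormedAddCommGroup V] [InnerProductSpace ℂ V] [FiniteDimensional ℂ V] [CompleteSpace V] in
theorem frameIdx_ne {σ τ : Shape k} {a : unitInterval × (Fin (σ.dim p) → V)}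
    {b : unitInterval × (Fin (τ.dim p) → V)} (h : σ ≠ τ) :
    (⟨(σ, a.1), a.2⟩ : FrameIdx p V) ≠ ⟨(τ, b.1), b.2⟩ := fun h' =>
  h (congrArg (fun F : FrameIdx p V => F.1.1) h')

omit [NormedAddCommGroup V] [InnerProductSpace ℂ V] [FiniteDimensional ℂ V] [CompleteSpace V] in
theorem frameIdx_injective (σ : Shape k) : Function.Injective
    fun a : unitInterval × (Fin (σ.dim p) → V) => (⟨(σ, a.1), a.2⟩ : FrameIdx p V) := by
  rintro ⟨x, w⟩ ⟨y, w'⟩ h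
  simp only [Sigma.mk.injEq, Prod.mk.injEq, true_and] at h
  obtain ⟨rfl, h⟩ := h
  rw [eq_of_heq h]

omit [NormedAddCommGroup V] [InnerProductSpace ℂ V] [FiniteDimensional ℂ V] [CompleteSpace V] in
/-- The shape-`σ` part of a finite set of frames can be listed in the order of the points. -/
theorem exists_enum {S : Set (FrameIdx p V)} (hS : S.Finite) (σ : Shape k) :
    ∃ (n : ℕ) (e : Fin n ≃ frameFiber S σ), Monotone fun j => (e j).1.1 := by
  have hfin : Finite (frameFiber S σ) :=
    Set.finite_coe_iff.2 (hS.preimage (frameIdx_injective σ).injOn)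
  let e := (Finite.equivFin (frameFiber S σ)).symm
  exact ⟨_, (Tuple.sort fun j => (e j).1.1).trans e, Tuple.monotone_sort fun j => (e j).1.1⟩

omit [FiniteDimensional ℂ V] in
/-- In a set of frames extending a maximal set of evaluation frames, there are not enough frames
at an end of a summand to make up an evaluation. -/
theorem card_lt_of_maximal {Φ : FinSum p →⋆ₙₐ[ℂ] (V →L[ℂ] V)} {S₁ S : Set (FrameIdx p V)}
    (hS₁ : Maximal (IsFrameSet Φ (fun j : Shape k × unitInterval => j.1.hom p j.2)
      fun j => ∃ i, j.1 = .mid i) S₁)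
    {Q : Shape k × unitInterval → Prop}
    (hS : IsFrameSet Φ (fun j : Shape k × unitInterval => j.1.hom p j.2) Q S)
    (hsub : S₁ ⊆ S) {σ : Shape k} {i : Fin k} (hσ : ∀ i, σ ≠ .mid i) (x : unitInterval)
    (hdvd : σ.dim p ∣ (p i).m)
    (hπ : ∀ (y : unitInterval) (f : FinSum p), (f i).1 x = tensorOne hdvd (σ.hom p y f)) {n : ℕ}
    (e : Fin n ≃ frameFiber S σ) : n < (p i).m / σ.dim p := by
  by_contra! hle
  have hq : 0 < (p i).m / σ.dim p := Nat.div_pos (Nat.le_of_dvd (p i).pos hdvd) (σ.dim_pos p)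
  let c : Fin ((p i).m / σ.dim p) → Fin n := Fin.castLE hle
  have hc : Function.Injective c := Fin.castLE_injective hle
  let w : Fin ((p i).m / σ.dim p) → Fin (σ.dim p) → V := fun a => (e (c a)).1.2
  have hom_eq : ∀ y y' f, σ.hom p y f = σ.hom p y' f := fun y y' f => by
    cases σ with
    | mid i => exact absurd rfl (hσ i)
    | _ => rfl
  have hw : ∀ a, IsFrame Φ (σ.hom p x) (w a) := fun a => by
    have h1 := hS.isFrame _ (e (c a)).2
    refine ⟨h1.orthonormal, fun f l => ?_⟩
    rw [h1.apply]
    refine Finset.sum_congr rfl fun l' _ => ?_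
    simp only
    rw [hom_eq _ x]
  have hp : ∀ a b, a ≠ b → ∀ l l', inner ℂ (w a l) (w b l') = 0 := fun a b hab => by
    refine hS.pairwise (e (c a)).2 (e (c b)).2 fun h => hab ?_
    exact hc (e.injective (Subtype.ext (frameIdx_injective σ h)))
  have hframe : IsFrame Φ (evalHom p i x) _ :=
    IsFrame.tensor hdvd (fun f => hπ x f) hw hp
  set W : Fin (p i).m → V :=
    fun a => w ((tensorIndex hdvd).symm a).2 ((tensorIndex hdvd).symm a).1 with hW
  have hperp : ∀ a, ∀ G ∈ S₁, ∀ l l', inner ℂ (w a l) (G.2 l') = 0 := fun a G hG => by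
    refine hS.pairwise (e (c a)).2 (hsub hG) fun h => ?_
    obtain ⟨i', hi'⟩ := hS₁.prop.cond G hG
    rw [← h] at hi'
    exact hσ i' hi'
  -- The end frames assemble to an evaluation frame orthogonal to all of `S₁`; maximality puts it
  -- into `S₁`, hence makes it orthogonal to itself.
  have hmem : (⟨(.mid i, x), W⟩ : FrameIdx p V) ∈ S₁ :=
    mem_of_maximal_isFrameSet hS₁ (F := ⟨(.mid i, x), W⟩) hframe ⟨i, rfl⟩
      fun G hG _ l l' => hperp _ G hG _ l'
  have h0 := hperp ((tensorIndex hdvd).symm ⟨0, (p i).pos⟩).2 _ hmem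
    ((tensorIndex hdvd).symm ⟨0, (p i).pos⟩).1 ⟨0, (p i).pos⟩
  exact hframe.orthonormal.ne_zero ⟨0, (p i).pos⟩ (inner_self_eq_zero.1 h0)

theorem exists_decomposition {Φ : FinSum p →⋆ₙₐ[ℂ] (V →L[ℂ] V)} (hΦ : ∀ f, ‖Φ f‖ ≤ ‖f‖) :
    ∃ n, Nonempty (Decomposition Φ n) := by
  -- The order of the two maximal choices matters: evaluation frames are exhausted before other
  -- shapes are admitted, which is what bounds the end multiplicities.
  obtain ⟨S₁, -, hS₁⟩ := IsFrameSet.exists_maximal (Φ := Φ)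
    (π := fun j : Shape k × unitInterval => j.1.hom p j.2) (Q := fun j => ∃ i, j.1 = .mid i)
    (S := ∅) ⟨by simp, by simp, by simp⟩
  obtain ⟨S, hsub, hS⟩ := IsFrameSet.exists_maximal (Φ := Φ)
    (π := fun j : Shape k × unitInterval => j.1.hom p j.2) (Q := fun _ => True)
    (S := S₁) ⟨hS₁.prop.isFrame, fun _ _ => trivial, hS₁.prop.pairwise⟩
  have hspan := span_eq_top_of_maximal (fun j => j.1.dim_pos p)
    (fun W hW hinv => exists_isFrame hΦ hW hinv) hS
  choose n e he using exists_enum (hS.prop.finite fun j => j.1.dim_pos p)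
  have horth : Orthonormal ℂ fun a : Σ σ : Shape k, Fin (n σ) × Fin (σ.dim p) =>
      (e a.1 a.2.1).1.2 a.2.2 := by
    refine ⟨fun a => (hS.prop.isFrame _ (e a.1 a.2.1).2).orthonormal.norm_eq_one _, ?_⟩
    rintro ⟨σ, j, l⟩ ⟨τ, j', l'⟩ hne
    by_cases hστ : σ = τ
    · subst hστ
      by_cases hj : j = j'
      · subst hj
        refine (hS.prop.isFrame _ (e σ j).2).orthonormal.inner_eq_zero fun h => hne ?_
        exact congrArg (fun l => (⟨σ, j, l⟩ : Σ σ : Shape k, Fin (n σ) × Fin (σ.dim p))) h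
      · refine hS.prop.pairwise (e σ j).2 (e σ j').2 (fun h => hj ?_) l l'
        exact (e σ).injective (Subtype.ext (frameIdx_injective σ h))
    · exact hS.prop.pairwise (e σ j).2 (e τ j').2 (frameIdx_ne hστ) l l'
  have hspan' : ⊤ ≤ Submodule.span ℂ (Set.range
      fun a : Σ σ : Shape k, Fin (n σ) × Fin (σ.dim p) => (e a.1 a.2.1).1.2 a.2.2) := by
    rw [← hspan]
    refine Submodule.span_mono ?_
    rintro _ ⟨⟨⟨⟨⟨σ, x⟩, w⟩, hF⟩, l⟩, rfl⟩
    refine ⟨⟨σ, (e σ).symm ⟨(x, w), hF⟩, l⟩, ?_⟩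
    simp
  refine ⟨n, ⟨fun σ j => (e σ j).1.1, he, OrthonormalBasis.mk horth hspan', ?_, ?_, ?_⟩⟩
  · intro f σ j l
    simp only [OrthonormalBasis.coe_mk]
    exact (hS.prop.isFrame _ (e σ j).2).apply f l
  · intro i
    exact card_lt_of_maximal (σ := .left i) hS₁ hS.prop hsub (fun _ h => by cases h) 0 (p i).dvd₀
      (fun _ f => (tensorOne_leftHom p i f).symm) (e _)
  · intro i
    exact card_lt_of_maximal (σ := .right i) hS₁ hS.prop hsub (fun _ h => by cases h) 1 (p i).dvd₁
      (fun _ f => (tensorOne_rightHom p i f).symm) (e _)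

end Decomposition

/-! ### Multiplicities and points read off from eigenvalue counts. -/

section Heights

variable {k : ℕ} {p : Fin k → Params}

/-- The value of the `i`-th height function in the representation of type `σ` at `x`. -/
noncomputable def Shape.height (i : Fin k) (x : unitInterval) : Shape k → ℝ
  | .zero => 0
  | .left j => if j = i then 1 else 0
  | .mid j => if j = i then 1 + (x : ℝ) else 0
  | .right j => if j = i then 2 else 0

theorem corner_algebraMap {k m : ℕ} (h : k ∣ m) (hm : 0 < m) (c : ℂ) :
    corner h hm (algebraMap ℂ _ c) = algebraMap ℂ _ c := by
  rw [← tensorOne_scalar h, corner_tensorOne]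

theorem hom_central_heightFun (i : Fin k) (x : unitInterval) (σ : Shape k) :
    σ.hom p x (central p i heightFun) = algebraMap ℂ _ (σ.height i x : ℂ) := by
  cases σ with
  | zero => exact (map_zero (algebraMap ℂ (Matrix (Fin 1) (Fin 1) ℂ))).symm
  | left j =>
    change corner (p j).dvd₀ (p j).pos ((central p i heightFun j).1 0) = _
    by_cases h : j = i
    · subst h
      rw [central_apply_self, corner_algebraMap]
      simp [Shape.height, heightFun_apply]
      rfl
    · rw [central_apply_of_ne h]
      simp only [Shape.height, if_neg h, Complex.ofReal_zero, map_zero]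
      rfl
  | mid j =>
    change (central p i heightFun j).1 x = _
    by_cases h : j = i
    · subst h
      rw [central_apply_self]
      simp [Shape.height, heightFun_apply]
      rfl
    · rw [central_apply_of_ne h]
      simp only [Shape.height, if_neg h, Complex.ofReal_zero, map_zero]
      rfl
  | right j =>
    change corner (p j).dvd₁ (p j).pos ((central p i heightFun j).1 1) = _
    by_cases h : j = i
    · subst h
      rw [central_apply_self, corner_algebraMap]
      simp only [Shape.height, heightFun_apply, if_true]
      norm_num
      rfl
    · rw [central_apply_of_ne h]
      simp only [Shape.height, if_neg h, Complex.ofReal_zero, map_zero]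
      rfl

variable {V : Type*} [NormedAddCommGroup V] [InnerProductSpace ℂ V]
  [FiniteDimensional ℂ V] [CompleteSpace V] {Φ Φ' : FinSum p →⋆ₙₐ[ℂ] (V →L[ℂ] V)}
  {n n' : Shape k → ℕ}

omit [FiniteDimensional ℂ V] in
theorem Decomposition.apply_height (𝒟 : Decomposition Φ n) (i : Fin k)
    (a : Σ σ : Shape k, Fin (n σ) × Fin (σ.dim p)) :
    Φ (central p i heightFun) (𝒟.basis a) =
      ((a.1.height i (𝒟.x a.1 a.2.1) : ℝ) : ℂ) • 𝒟.basis a := by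
  obtain ⟨σ, j, l⟩ := a
  rw [𝒟.apply, hom_central_heightFun, Finset.sum_eq_single l]
  · rw [Matrix.algebraMap_matrix_apply, if_pos rfl]
    rfl
  · intro l' _ h
    rw [Matrix.algebraMap_matrix_apply, if_neg h, zero_smul]
  · simp

theorem Decomposition.eigenCount_eq_sum (𝒟 : Decomposition Φ n) (i : Fin k) (y : ℝ) :
    eigenCount (Φ (central p i heightFun)) y =
      ∑ σ : Shape k, σ.dim p *
        (Finset.univ.filter fun j : Fin (n σ) => y < σ.height i (𝒟.x σ j)).card := by
  rw [eigenCount_eq_card 𝒟.basis (𝒟.apply_height i), Finset.card_filter, Fintype.sum_sigma]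
  refine Finset.sum_congr rfl fun σ _ => ?_
  rw [Fintype.sum_prod_type, Finset.card_filter, Finset.mul_sum]
  refine Finset.sum_congr rfl fun j _ => ?_
  by_cases h : y < σ.height i (𝒟.x σ j) <;> simp [h]

theorem Decomposition.eigenCount_eq (𝒟 : Decomposition Φ n) (i : Fin k) {y : ℝ} (hy : 0 ≤ y) :
    eigenCount (Φ (central p i heightFun)) y =
      (p i).m₀ * (Finset.univ.filter fun _ : Fin (n (.left i)) => y < 1).card +
      (p i).m * (Finset.univ.filter fun j => y < 1 + (𝒟.x (.mid i) j : ℝ)).card +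
      (p i).m₁ * (Finset.univ.filter fun _ : Fin (n (.right i)) => y < 2).card := by
  rw [𝒟.eigenCount_eq_sum,
    ← Finset.sum_subset (Finset.subset_univ ({.left i, .mid i, .right i} : Finset (Shape k)))]
  · rw [Finset.sum_insert (by simp), Finset.sum_insert (by simp), Finset.sum_singleton, ← add_assoc]
    simp only [Shape.height, if_true]
    rfl
  · intro σ _ hσ
    have h0 : ∀ x, σ.height i x = 0 := fun x => by
      cases σ with
      | zero => rfl
      | left j => exact if_neg fun h => hσ (by simp [h])
      | mid j => exact if_neg fun h => hσ (by simp [h])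
      | right j => exact if_neg fun h => hσ (by simp [h])
    rw [Finset.filter_false_of_mem, Finset.card_empty, mul_zero]
    intro j _
    rw [h0]
    exact not_lt.2 hy

theorem Decomposition.eigenCount_of_lt_one (𝒟 : Decomposition Φ n) (i : Fin k) {y : ℝ} (hy : 0 ≤ y)
    (hy1 : y < 1) : eigenCount (Φ (central p i heightFun)) y =
      (p i).m₀ * n (.left i) + (p i).m * n (.mid i) + (p i).m₁ * n (.right i) := by
  rw [𝒟.eigenCount_eq i hy, Finset.filter_true_of_mem (fun _ _ => hy1),
    Finset.filter_true_of_mem (fun j _ => by linarith [(𝒟.x (.mid i) j).2.1]),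
    Finset.filter_true_of_mem (fun _ _ => by linarith)]
  simp

/-- From level `1` on, the left-end copies (height `1`) are no longer counted. Modulo `m` only the
right-end term survives, and it is below `m`. -/
theorem Decomposition.eigenCount_of_one_le (𝒟 : Decomposition Φ n) (i : Fin k) {y : ℝ} (hy : 1 ≤ y)
    (hy2 : y < 2) : eigenCount (Φ (central p i heightFun)) y =
      (p i).m * (Finset.univ.filter fun j => y < 1 + (𝒟.x (.mid i) j : ℝ)).card +
        (p i).m₁ * n (.right i) := by
  rw [𝒟.eigenCount_eq i (by linarith), Finset.filter_false_of_mem (fun _ _ => not_lt.2 hy),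
    Finset.filter_true_of_mem (s := (Finset.univ : Finset (Fin (n (.right i))))) (fun _ _ => hy2)]
  simp

omit [FiniteDimensional ℂ V] in
theorem Decomposition.mul_right_lt (𝒟 : Decomposition Φ n) (i : Fin k) :
    (p i).m₁ * n (.right i) < (p i).m := by
  have := (Nat.mul_lt_mul_left (p i).m₁_pos).2 (𝒟.right_lt i)
  rwa [Nat.mul_div_cancel' (p i).dvd₁] at this

omit [FiniteDimensional ℂ V] in
theorem Decomposition.mul_left_lt (𝒟 : Decomposition Φ n) (i : Fin k) :
    (p i).m₀ * n (.left i) < (p i).m := by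
  have := (Nat.mul_lt_mul_left (p i).m₀_pos).2 (𝒟.left_lt i)
  rwa [Nat.mul_div_cancel' (p i).dvd₀] at this

omit [FiniteDimensional ℂ V] in
theorem Decomposition.finrank_eq (𝒟 : Decomposition Φ n) :
    Module.finrank ℂ V = n .zero + ∑ σ ∈ {Shape.zero}ᶜ, n σ * σ.dim p := by
  rw [Module.finrank_eq_card_basis 𝒟.basis.toBasis, Fintype.card_sigma,
    Fintype.sum_eq_add_sum_compl Shape.zero]
  simp only [Fintype.card_prod, Fintype.card_fin]
  exact congrArg (· + _) (mul_one _)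

omit [FiniteDimensional ℂ V] in
/-- The multiplicities in the decomposition are determined by the multiplicities at the right ends
and the total multiplicities of the summands. -/
theorem Decomposition.mult_eq (𝒟 : Decomposition Φ n) (𝒟' : Decomposition Φ' n')
    (hr : ∀ i, n (.right i) = n' (.right i))
    (hs : ∀ i, (p i).m₀ * n (.left i) + (p i).m * n (.mid i) + (p i).m₁ * n (.right i) =
      (p i).m₀ * n' (.left i) + (p i).m * n' (.mid i) + (p i).m₁ * n' (.right i)) : n = n' := by
  have hlm : ∀ i, n (.left i) = n' (.left i) ∧ n (.mid i) = n' (.mid i) := fun i => by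
    have h1 := hs i
    rw [hr i, add_left_inj] at h1
    -- After cancelling the right-end term, the left-end term is the residue modulo `m` and the
    -- evaluation multiplicity the quotient.
    have h2 := congrArg (· % (p i).m) h1
    simp only [Nat.add_mul_mod_self_left, Nat.mod_eq_of_lt (𝒟.mul_left_lt i),
      Nat.mod_eq_of_lt (𝒟'.mul_left_lt i)] at h2
    rw [h2, add_right_inj] at h1
    exact ⟨Nat.eq_of_mul_eq_mul_left (p i).m₀_pos h2, Nat.eq_of_mul_eq_mul_left (p i).pos h1⟩
  have hne : ∀ σ, σ ≠ .zero → n σ = n' σ := fun σ hσ => by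
    cases σ with
    | zero => exact absurd rfl hσ
    | left i => exact (hlm i).1
    | mid i => exact (hlm i).2
    | right i => exact hr i
  funext σ
  by_cases hσ : σ = .zero
  · subst hσ
    -- The multiplicity of the zero representation, invisible to the heights, is what remains of the
    -- dimension.
    have h1 := 𝒟.finrank_eq
    rw [𝒟'.finrank_eq, Finset.sum_congr rfl fun σ hσ => by
      rw [← hne σ (by simpa using hσ)]] at h1
    exact (Nat.add_right_cancel h1).symm
  · exact hne σ hσ

/-- Along a path of representations, the multiplicities in the decomposition are constant. -/
theorem Decomposition.mult_eq_of_path {X : Type*} [TopologicalSpace X] [PreconnectedSpace X]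
    {φ : X → FinSum p →⋆ₙₐ[ℂ] (V →L[ℂ] V)} (hc : ∀ f, Continuous fun x => φ x f)
    {n : X → Shape k → ℕ} (𝒟 : ∀ x, Decomposition (φ x) (n x)) (s t : X) : n s = n t := by
  refine (𝒟 s).mult_eq (𝒟 t) (fun i => ?_) fun i => ?_
  · refine IsLocallyConstant.apply_eq_of_preconnectedSpace
      (f := fun x => n x (.right i)) ((IsLocallyConstant.iff_eventually_eq _).2 fun x => ?_) s t
    -- A level strictly between the heights of the two ends and off the finitely many evaluation
    -- heights at `x` is not an eigenvalue there, so its count is locally constant.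
    obtain ⟨y, ⟨hy1, hy2⟩, hy⟩ := ((Set.Ioo_infinite (one_lt_two (α := ℝ))).sdiff
      (Set.finite_range fun j => 1 + ((𝒟 x).x (.mid i) j : ℝ))).nonempty
    have h1 := eventually_eigenCount_eq_of_eigenbasis (hc (central p i heightFun)) (𝒟 x).basis
      ((𝒟 x).apply_height i) (y := y) (by
        rintro ⟨σ, j, l⟩ h
        cases σ with
        | zero => simp only [Shape.height] at h; linarith
        | left i' => simp only [Shape.height] at h; split_ifs at h <;> linarith
        | mid i' =>
          simp only [Shape.height] at h
          split_ifs at h with h'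
          · subst h'
            exact hy ⟨j, h⟩
          · linarith
        | right i' => simp only [Shape.height] at h; split_ifs at h <;> linarith)
    filter_upwards [h1] with x' hx'
    rw [(𝒟 x').eigenCount_of_one_le i hy1.le hy2, (𝒟 x).eigenCount_of_one_le i hy1.le hy2] at hx'
    have h2 := congrArg (· % (p i).m) hx'
    simp only [Nat.mul_add_mod_self_left, Nat.mod_eq_of_lt ((𝒟 x).mul_right_lt i),
      Nat.mod_eq_of_lt ((𝒟 x').mul_right_lt i)] at h2
    exact Nat.eq_of_mul_eq_mul_left (p i).m₁_pos h2
  · refine IsLocallyConstant.apply_eq_of_preconnectedSpace (f := fun x => (p i).m₀ * n x (.left i) +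
      (p i).m * n x (.mid i) + (p i).m₁ * n x (.right i))
      ((IsLocallyConstant.iff_eventually_eq _).2 fun x => ?_) s t
    have h1 := eventually_eigenCount_eq_of_eigenbasis (hc (central p i heightFun)) (𝒟 x).basis
      -- `1 / 2` lies in the gap between height `0` and the heights `[1, 2]` of the summand.
      ((𝒟 x).apply_height i) (y := 1 / 2) (by
        rintro ⟨σ, j, l⟩ h
        cases σ with
        | zero => simp only [Shape.height] at h; linarith
        | left i' => simp only [Shape.height] at h; split_ifs at h <;> linarith
        | mid i' =>
          have := ((𝒟 x).x (.mid i') j).2.1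
          simp only [Shape.height] at h
          split_ifs at h <;> linarith
        | right i' => simp only [Shape.height] at h; split_ifs at h <;> linarith)
    filter_upwards [h1] with x' hx'
    rwa [(𝒟 x').eigenCount_of_lt_one i (by norm_num) (by norm_num),
      (𝒟 x).eigenCount_of_lt_one i (by norm_num) (by norm_num)] at hx'

/-- If the eigenvalue counting functions of the heights are `δ`-close, then so are the points. -/
theorem Decomposition.x_le (𝒟 : Decomposition Φ n) (𝒟' : Decomposition Φ' n) {δ : ℝ} (hδ : 0 < δ)
    {i : Fin k} (h : ∀ y ∈ Set.Icc (0 : ℝ) 2, eigenCount (Φ (central p i heightFun)) (y + δ) ≤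
      eigenCount (Φ' (central p i heightFun)) y) (j : Fin (n (.mid i))) :
    (𝒟.x (.mid i) j : ℝ) ≤ 𝒟'.x (.mid i) j + δ := by
  refine le_add_of_card_filter_le (x := fun j => (𝒟.x (.mid i) j : ℝ))
    (x' := fun j => (𝒟'.x (.mid i) j : ℝ)) (fun a b hab => 𝒟.monotone _ hab)
    (fun a b hab => 𝒟'.monotone _ hab) ?_ j
  rintro _ ⟨j', rfl⟩
  set y := (𝒟'.x (.mid i) j' : ℝ) with hy
  have hy0 : 0 ≤ y := (𝒟'.x (.mid i) j').2.1
  have hy1 : y ≤ 1 := (𝒟'.x (.mid i) j').2.2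
  rcases le_or_gt 1 (y + δ) with h1 | h1
  · rw [Finset.filter_false_of_mem]
    · simp
    · exact fun a _ => not_lt.2 ((𝒟.x (.mid i) a).2.2.trans h1)
  -- Both levels `1 + y` and `1 + y + δ` lie in `[1, 2)`; the equal right-end terms cancel and the
  -- factor `m` is divided out.
  · have h2 := h (1 + y) ⟨by linarith, by linarith⟩
    rw [𝒟.eigenCount_of_one_le i (by linarith) (by linarith),
      𝒟'.eigenCount_of_one_le i (by linarith) (by linarith), add_le_add_iff_right] at h2
    have h3 := Nat.le_of_mul_le_mul_left h2 (p i).pos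
    simpa only [add_assoc, add_lt_add_iff_left] using h3

end Heights

/-! ### Matching two decompositions by a unitary. -/

section Unitary

/-- A block diagonal operator is bounded by the norms of its blocks. -/
theorem opNorm_le_of_blocks {V : Type*} [NormedAddCommGroup V] [InnerProductSpace ℂ V]
    {J : Type*} [Fintype J] {n d : J → ℕ}
    (b : OrthonormalBasis (Σ σ : J, Fin (n σ) × Fin (d σ)) ℂ V) {R : V →L[ℂ] V}
    {M : ∀ σ, Fin (n σ) → Matrix (Fin (d σ)) (Fin (d σ)) ℂ}
    (hR : ∀ σ j l, R (b ⟨σ, j, l⟩) = ∑ l', M σ j l' l • b ⟨σ, j, l'⟩) {ε : ℝ} (hε : 0 ≤ ε)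
    (hM : ∀ σ j, ‖M σ j‖ ≤ ε) : ‖R‖ ≤ ε := by
  classical
  refine ContinuousLinearMap.opNorm_le_bound _ hε fun v => ?_
  let c : ∀ σ, Fin (n σ) → EuclideanSpace ℂ (Fin (d σ)) := fun σ j =>
    WithLp.toLp 2 fun l => inner ℂ (b ⟨σ, j, l⟩) v
  have hRv : R v = ∑ σ, ∑ j, ∑ l', (M σ j).mulVec (c σ j).ofLp l' • b ⟨σ, j, l'⟩ := by
    conv_lhs => rw [← b.sum_repr' v]
    rw [map_sum, Fintype.sum_sigma]
    refine Finset.sum_congr rfl fun σ _ => ?_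
    rw [Fintype.sum_prod_type]
    refine Finset.sum_congr rfl fun j _ => ?_
    simp only [map_smul, hR, Finset.smul_sum, smul_smul]
    rw [Finset.sum_comm]
    refine Finset.sum_congr rfl fun l' _ => ?_
    rw [← Finset.sum_smul]
    congr 1
    exact Finset.sum_congr rfl fun l _ => mul_comm _ _
  have hcoef : ∀ σ j l', inner ℂ (b ⟨σ, j, l'⟩) (R v) = (M σ j).mulVec (c σ j).ofLp l' := by
    intro σ j l'
    have h1 : R v = ∑ a : Σ σ : J, Fin (n σ) × Fin (d σ),
        (M a.1 a.2.1).mulVec (c a.1 a.2.1).ofLp a.2.2 • b a := by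
      rw [hRv, Fintype.sum_sigma]
      refine Finset.sum_congr rfl fun σ _ => ?_
      rw [Fintype.sum_prod_type]
    rw [h1, b.orthonormal.inner_right_fintype]
  have hblock : ∀ σ j, ∑ l', ‖inner ℂ (b ⟨σ, j, l'⟩) (R v)‖ ^ 2 ≤
      ε ^ 2 * ∑ l, ‖inner ℂ (b ⟨σ, j, l⟩) v‖ ^ 2 := by
    intro σ j
    have h1 := Matrix.l2_opNorm_mulVec (M σ j) (c σ j)
    have h2 : ‖(EuclideanSpace.equiv (Fin (d σ)) ℂ).symm ((M σ j).mulVec (c σ j).ofLp)‖ ≤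
        ε * ‖c σ j‖ := h1.trans (by gcongr; exact hM σ j)
    have h3 := pow_le_pow_left₀ (norm_nonneg _) h2 2
    rw [mul_pow, EuclideanSpace.norm_sq_eq, EuclideanSpace.norm_sq_eq] at h3
    simp only [hcoef]
    exact h3
  have hsq : ‖R v‖ ^ 2 ≤ (ε * ‖v‖) ^ 2 := by
    rw [mul_pow, ← b.sum_sq_norm_inner_right (R v), ← b.sum_sq_norm_inner_right v,
      Fintype.sum_sigma, Fintype.sum_sigma, Finset.mul_sum]
    refine Finset.sum_le_sum fun σ _ => ?_
    rw [Fintype.sum_prod_type, Fintype.sum_prod_type, Finset.mul_sum]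
    exact Finset.sum_le_sum fun j _ => hblock σ j
  exact (sq_le_sq₀ (norm_nonneg _) (by positivity)).1 hsq

variable {k : ℕ} {p : Fin k → Params} {V : Type*} [NormedAddCommGroup V] [InnerProductSpace ℂ V]
  [FiniteDimensional ℂ V] [CompleteSpace V] {Φ Φ' : FinSum p →⋆ₙₐ[ℂ] (V →L[ℂ] V)}
  {n : Shape k → ℕ}

theorem norm_hom_sub_le {f : FinSum p} {ε : ℝ} (hε : 0 ≤ ε) {σ : Shape k} {x y : unitInterval}
    (h : ∀ i, σ = .mid i → ‖(f i).1 x - (f i).1 y‖ ≤ ε) :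
    ‖σ.hom p x f - σ.hom p y f‖ ≤ ε := by
  cases σ with
  | mid i => exact h i rfl
  | zero => exact (congrArg norm (sub_self (Shape.hom p x _ f))).trans_le (norm_zero.trans_le hε)
  | left i => exact (congrArg norm (sub_self (Shape.hom p x _ f))).trans_le (norm_zero.trans_le hε)
  | right i => exact (congrArg norm (sub_self (Shape.hom p x _ f))).trans_le (norm_zero.trans_le hε)

/-- The unitary which identifies two decompositions with the same multiplicities. -/
noncomputable def Decomposition.unitary (𝒟 : Decomposition Φ n) (𝒟' : Decomposition Φ' n) :
    unitary (V →L[ℂ] V) :=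
  Unitary.linearIsometryEquiv.symm (𝒟.basis.equiv 𝒟'.basis (Equiv.refl _))

omit [FiniteDimensional ℂ V] in
-- In the basis of `𝒟'` the difference is block diagonal. Only the evaluation blocks depend on the
-- points, so all other blocks vanish.
theorem Decomposition.norm_conj_sub_le (𝒟 : Decomposition Φ n) (𝒟' : Decomposition Φ' n)
    {f : FinSum p} {ε : ℝ} (hε : 0 ≤ ε)
    (h : ∀ i j, ‖(f i).1 (𝒟.x (.mid i) j) - (f i).1 (𝒟'.x (.mid i) j)‖ ≤ ε) :
    ‖(𝒟.unitary 𝒟' : V →L[ℂ] V) * Φ f * star (𝒟.unitary 𝒟' : V →L[ℂ] V) - Φ' f‖ ≤ ε := by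
  set u := 𝒟.unitary 𝒟' with hu
  have h1 : ∀ a, (u : V →L[ℂ] V) (𝒟.basis a) = 𝒟'.basis a := fun a =>
    𝒟.basis.equiv_apply_basis 𝒟'.basis (Equiv.refl _) a
  have h2 : ∀ a, star (u : V →L[ℂ] V) (𝒟'.basis a) = 𝒟.basis a := fun a => by
    rw [← h1 a]
    exact congrArg (fun T : V →L[ℂ] V => T (𝒟.basis a)) (Unitary.coe_star_mul_self u)
  refine opNorm_le_of_blocks 𝒟'.basis
    (M := fun σ j => σ.hom p (𝒟.x σ j) f - σ.hom p (𝒟'.x σ j) f) (fun σ j l => ?_) hε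
    fun σ j => norm_hom_sub_le hε fun i hi => ?_
  · have h3 : ((u : V →L[ℂ] V) * Φ f * star (u : V →L[ℂ] V) - Φ' f) (𝒟'.basis ⟨σ, j, l⟩) =
        (u : V →L[ℂ] V) (Φ f (star (u : V →L[ℂ] V) (𝒟'.basis ⟨σ, j, l⟩))) -
          Φ' f (𝒟'.basis ⟨σ, j, l⟩) := rfl
    rw [h3, h2, 𝒟.apply, 𝒟'.apply, map_sum, ← Finset.sum_sub_distrib]
    refine Finset.sum_congr rfl fun l' _ => ?_
    rw [map_smul, h1, Matrix.sub_apply, sub_smul]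
  · subst hi
    exact h i j

end Unitary

/-! ### Conclusion for the weak variation. -/

section Main

/-- Matrix version of approximate unitary equivalence of representations. -/
theorem exists_unitaryGroup_norm_le {N : ℕ}
    (u : unitary (EuclideanSpace ℂ (Fin N) →L[ℂ] EuclideanSpace ℂ (Fin N))) :
    ∃ w : Matrix.unitaryGroup (Fin N) ℂ, ∀ M M' : Matrix (Fin N) (Fin N) ℂ,
      ‖(w : Matrix (Fin N) (Fin N) ℂ) * M * star (w : Matrix (Fin N) (Fin N) ℂ) - M'‖ =
      ‖(u : EuclideanSpace ℂ (Fin N) →L[ℂ] EuclideanSpace ℂ (Fin N)) *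
        Matrix.toEuclideanCLM (𝕜 := ℂ) M * star (u : _ →L[ℂ] _) -
        Matrix.toEuclideanCLM (𝕜 := ℂ) M'‖ := by
  let τ := Matrix.toEuclideanCLM (𝕜 := ℂ) (n := Fin N)
  have h : τ (τ.symm u) = u := τ.apply_symm_apply _
  have hm : τ.symm u ∈ Matrix.unitaryGroup (Fin N) ℂ := by
    refine Matrix.mem_unitaryGroup_iff.2 (EquivLike.injective τ ?_)
    rw [map_mul, map_star, h, map_one]
    exact Unitary.mul_star_self_of_mem u.2
  refine ⟨⟨τ.symm u, hm⟩, fun M M' => ?_⟩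
  · rw [Matrix.cstar_norm_def, map_sub, map_mul, map_mul, map_star]
    change ‖τ (τ.symm u) * τ M * star (τ (τ.symm u)) - τ M'‖ = _
    rw [h]

/-- Uniform continuity of finitely many elements. -/
theorem exists_delta {k : ℕ} {p : Fin k → Params} {F : Set (FinSum p)} (hF : F.Finite) {ε : ℝ}
    (hε : 0 < ε) : ∃ δ > 0, ∀ f ∈ F, ∀ i, ∀ x y : unitInterval, |(x : ℝ) - y| ≤ δ →
      ‖(f i).1 x - (f i).1 y‖ ≤ ε := by
  have h : ∀ᶠ δ : ℝ in 𝓝[>] 0, ∀ f ∈ F, ∀ i, ∀ x y : unitInterval, |(x : ℝ) - y| ≤ δ →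
      ‖(f i).1 x - (f i).1 y‖ ≤ ε := by
    refine (eventually_all_finite hF).2 fun f _ => eventually_all.2 fun i => ?_
    obtain ⟨δ, hδ, h⟩ := Metric.uniformContinuous_iff.1
      (CompactSpace.uniformContinuous_of_continuous (f i).1.continuous) ε hε
    filter_upwards [nhdsWithin_le_nhds (eventually_lt_nhds hδ)] with δ' hδ' x y hxy
    have h1 := h (a := x) (b := y) (by
      rw [Subtype.dist_eq, Real.dist_eq]
      exact hxy.trans_lt hδ')
    rw [dist_eq_norm] at h1
    exact h1.le
  obtain ⟨δ, h1, h2⟩ := (h.and self_mem_nhdsWithin).exists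
  exact ⟨δ, h2, h1⟩

theorem weakVariation_le {k : ℕ} {p : Fin k → Params} {F : Set (FinSum p)} {ε : ℝ}
    (h : ∀ i (s t : unitInterval), ∃ u : Matrix.unitaryGroup (Fin (p i).m) ℂ, ∀ f ∈ F,
      ‖(u : Matrix (Fin (p i).m) (Fin (p i).m) ℂ) * (f i).1 s *
        star (u : Matrix (Fin (p i).m) (Fin (p i).m) ℂ) - (f i).1 t‖ ≤ ε) :
    weakVariation F ≤ ENNReal.ofReal ε := by
  refine iSup_le fun i => iSup_le fun s => iSup_le fun t => ?_
  obtain ⟨u, hu⟩ := h i s t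
  refine iInf_le_of_le u (iSup₂_le fun f hf => ?_)
  rw [← ofReal_norm]
  exact ENNReal.ofReal_le_ofReal (hu f hf)

/-- The weak variation of a finite set becomes arbitrarily small in a limit of real rank zero. -/
theorem IsInductiveLimit.exists_weakVariation_le
    {k : ℕ → ℕ} {p : ∀ n, Fin (k n) → Params}
    {ν : ∀ n m, n ≤ m → (FinSum (p n) →⋆ₙₐ[ℂ] FinSum (p m))}
    (hν : IsInductiveSequence (A := fun n => FinSum (p n)) ν)
    {A : Type*} [NonUnitalCStarAlgebra A] {ι : ∀ n, FinSum (p n) →⋆ₙₐ[ℂ] A}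
    (hA : IsInductiveLimit (A := fun n => FinSum (p n)) ν ι) (hrr : RealRankZero A)
    (n : ℕ) {F : Set (FinSum (p n))} (hF : F.Finite) {ε : ℝ} (hε : 0 < ε) :
    ∃ r₀, ∀ r (hr : n ≤ r), r₀ ≤ r → weakVariation (ν n r hr '' F) ≤ ENNReal.ofReal ε := by
  obtain ⟨δ, hδ, hF'⟩ := exists_delta hF hε
  choose g hg using fun i => hA.exists_eigenCount_le hν hrr
    (isSelfAdjoint_central (p := p n) i isSelfAdjoint_heightFun) hδ
  refine ⟨Finset.univ.sup g, fun r hr hrr => weakVariation_le fun i' s t => ?_⟩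
  let φ : unitInterval → FinSum (p n) →⋆ₙₐ[ℂ]
      (EuclideanSpace ℂ (Fin (p r i').m) →L[ℂ] EuclideanSpace ℂ (Fin (p r i').m)) :=
    fun x => (evalRep (p r) i' x).comp (ν n r hr)
  have hφ : ∀ x f, ‖φ x f‖ ≤ ‖f‖ := fun x f =>
    (norm_evalRep_le i' x _).trans (NonUnitalStarAlgHom.norm_apply_le (ν n r hr) f)
  have hφc : ∀ f, Continuous fun x => φ x f := fun f => continuous_evalRep i' (ν n r hr f)
  choose mult hmult using fun x => exists_decomposition (hφ x)
  have hpath := Decomposition.mult_eq_of_path hφc (fun x => (hmult x).some) s t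
  obtain ⟨𝒟⟩ := hmult s
  obtain ⟨𝒟'⟩ := hmult t
  rw [← hpath] at 𝒟'
  have hclose : ∀ i s t, ∀ y ∈ Set.Icc (0 : ℝ) 2,
      eigenCount (φ s (central (p n) i heightFun)) (y + δ) ≤
        eigenCount (φ t (central (p n) i heightFun)) y := fun i s t =>
    hg i r hr ((Finset.le_sup (Finset.mem_univ i)).trans hrr) (fun x => evalRep (p r) i' x)
      (norm_evalRep_le i') (continuous_evalRep i') s t
  have hx : ∀ i j, |(𝒟.x (.mid i) j : ℝ) - 𝒟'.x (.mid i) j| ≤ δ := fun i j => by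
    have h1 := 𝒟.x_le 𝒟' hδ (hclose i s t) j
    have h2 := 𝒟'.x_le 𝒟 hδ (hclose i t s) j
    rw [abs_le]
    -- The counting estimate is used in both directions, with `s` and `t` exchanged, to get a
    -- two-sided bound.
    constructor <;> linarith
  obtain ⟨w, hw⟩ := exists_unitaryGroup_norm_le (𝒟.unitary 𝒟')
  refine ⟨w, ?_⟩
  rintro _ ⟨f, hf, rfl⟩
  rw [hw]
  exact 𝒟.norm_conj_sub_le 𝒟' hε.le fun i j => hF' f hf i _ _ (hx i j)

end Main
end DimDrop

theorem corollary3p6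
    {k : ℕ → ℕ} (p : ∀ n, Fin (k n) → DimDrop.Params)
    (ν : ∀ n m, n ≤ m → (DimDrop.FinSum (p n) →⋆ₙₐ[ℂ] DimDrop.FinSum (p m)))
    (hν : DimDrop.IsInductiveSequence (A := fun n => DimDrop.FinSum (p n)) ν)
    {A : Type*} [NonUnitalCStarAlgebra A]
    (ι : ∀ n, DimDrop.FinSum (p n) →⋆ₙₐ[ℂ] A)
    (hA : DimDrop.IsInductiveLimit (A := fun n => DimDrop.FinSum (p n)) ν ι)
    (hrr : DimDrop.RealRankZero A)
    (n : ℕ) (F : Set (DimDrop.FinSum (p n))) (hF : F.Finite) :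
    Tendsto (fun r : Set.Ici n => DimDrop.weakVariation (ν n r r.2 '' F)) atTop (𝓝 0) := by
  refine ENNReal.tendsto_nhds_zero.2 fun ε hε => ?_
  obtain ⟨e, he0, heε⟩ := ENNReal.lt_iff_exists_nnreal_btwn.1 hε
  obtain ⟨r₀, h⟩ := hA.exists_weakVariation_le hν hrr n hF
    (NNReal.coe_pos.2 (ENNReal.coe_pos.1 he0))
  refine eventually_atTop.2 ⟨⟨max n r₀, Set.mem_Ici.2 (le_max_left _ _)⟩, fun r hr => ?_⟩
  have h1 := h r r.2 ((le_max_right n r₀).trans hr)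
  rw [ENNReal.ofReal_coe_nnreal] at h1
  exact h1.trans heε.le
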